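/- For a prime $p$, count the three-term arithmetic progressions of a set $S\subseteq\mathbb Z/p\mathbb Z$ as the triples $(n,n+m,n+2m)$ with $n,m\in\mathbb Z/p\mathbb Z$ and all three entries in $S$; trivial progressions ($m=0$) are included, and a progression and its reversal are counted separately. For $0<d\le 1$, call $S$ a critical set for the density $d$ if $|S|\ge dp$ and $S$ has the least number of three-term arithmetic progressions among all subsets of $\mathbb Z/p\mathbb Z$ with at least $dp$ elements. An arithmetic progression of length $k$ in $\mathbb Z/p\mathbb Z$ is a set $\{a,a+r,\dots,a+(k-1)r\}$ whose $k$ listed terms are distinct. Theorem. There is a function $\varepsilon:\mathbb N\to\mathbb R$ with $\varepsilon(p)\to 0$ as $p\to\infty$ (written $o(1)$ below) such that for every $0<d\le 1$ the following hold. 1. For all sufficiently large primes $p$ (depending on $d$), every critical set $S\subseteq\mathbb Z/p\mathbb Z$ for the density $d$ contains an arithmetic progression of length at least $(\log p)^{1/4+o(1)}$. 2. For every real $L\ge 1$ and all sufficiently large primes $p$ (depending on $d$ and $L$), for every critical set $S\subseteq\mathbb Z/p\mathbb Z$ for the density $d$ there is an arithmetic progression $N\subseteq\mathbb Z/p\mathbb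 Z$ of length at least $(\log p)^L$ such that $$|S\cap N| > |N|\left(1-\frac{1}{(\log p)^{1/4+o(1)}}\right).$$ -/

import Mathlib

/-- The number of three-term arithmetic progressions `n, n + m, n + 2m` in `S`. Trivial progressions
(`m = 0`) are counted, and a progression and its reversal are counted separately. -/
def threeAPCount {p : ℕ} [NeZero p] (S : Finset (ZMod p)) : ℕ :=
  (Finset.univ.filter fun x : ZMod p × ZMod p =>
    x.1 ∈ S ∧ x.1 + x.2 ∈ S ∧ x.1 + 2 * x.2 ∈ S).card

/-- `S` has at least `d * p` elements and the least number of three-term arithmetic progressions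
among all subsets of `ZMod p` with at least `d * p` elements. -/
def IsCriticalSet {p : ℕ} [NeZero p] (d : ℝ) (S : Finset (ZMod p)) : Prop :=
  d * p ≤ S.card ∧
    ∀ T : Finset (ZMod p), d * p ≤ T.card → threeAPCount S ≤ threeAPCount T

/-- `N` is the set of terms `a, a + r, …, a + (k - 1) r` of an arithmetic progression modulo `p`
of length `k`, where the `k` terms are required to be distinct. -/
def IsAPOfLength {p : ℕ} (N : Finset (ZMod p)) (k : ℕ) : Prop :=
  ∃ a r : ZMod p, N = (Finset.range k).image (fun j : ℕ => a + (j : ZMod p) * r) ∧ N.card = k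

/-! A critical set `S` cannot be spread out evenly. By Varnavides' theorem
(`exists_forall_le_apSumNT`) it has at least `c p²` nontrivial progressions. Fourier analysis
(`exists_step_abs_apSum_sub_le`) gives a step `r ≠ 0` such that replacing the indicator of `S` by
its averages `g` over progressions of step `r` and length `k` hardly changes the count: only
frequencies with a large coefficient matter, there are at most `τ⁻²` of them, and Dirichlet's
pigeonhole makes `r` nearly annihilate them all.

If every average were at most `1 - x`, there would be room to thin `g`. The complement `W` of an
interval of length `x p` has fewer progressions than a random set of its density, by a relative
amount of order `x²`. Multiply `g` by a random affine copy of `W` rescaled to mean one. The values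
stay in `[0, 1]` because `g ≤ 1 - x`, the mass is nearly preserved, and the expected count drops by
a factor of about `1 - x² / 18`. Rounding (`exists_finset_rounding`) and adding a few points yield a
set at least as large as `S` (`exists_finset_fewer_ap`), with fewer progressions once the errors are
below `c x² / 18`. So some average exceeds `1 - x` (`IsCriticalSet.exists_apAverage_gt`).

The pigeonhole needs `τ⁻² log Q < log p` with `τ` of order `x²` and `Q` a power of `log p`; hence
`x` can be as small as `(log p)^(-1/4 + o(1))`. This is the second claim. For the first, cut a
progression of length about `log p` into blocks of length at most `1 / (2 x)`: some block contains
no missing point. -/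

open Finset

/-! ### Weighted progression counts -/

/-- The weighted count of three-term arithmetic progressions. -/
def apSum {p : ℕ} [NeZero p] (f : ZMod p → ℝ) : ℝ :=
  ∑ n, ∑ m, f n * f (n + m) * f (n + 2 * m)

/-- The weighted count of nontrivial three-term arithmetic progressions. -/
def apSumNT {p : ℕ} [NeZero p] (f : ZMod p → ℝ) : ℝ :=
  ∑ n, ∑ m ∈ univ.erase (0 : ZMod p), f n * f (n + m) * f (n + 2 * m)

/-- The real-valued indicator function of a finite set. -/
def ind {α : Type*} [DecidableEq α] (S : Finset α) (x : α) : ℝ := if x ∈ S then 1 else 0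

lemma ind_nonneg {α : Type*} [DecidableEq α] (S : Finset α) (x : α) : 0 ≤ ind S x := by
  unfold ind; split_ifs <;> norm_num

lemma ind_le_one {α : Type*} [DecidableEq α] (S : Finset α) (x : α) : ind S x ≤ 1 := by
  unfold ind; split_ifs <;> norm_num

lemma sum_ind {α : Type*} [DecidableEq α] [Fintype α] (S : Finset α) :
    ∑ x, ind S x = S.card := by
  simp [ind]

section

variable {p : ℕ} [NeZero p]

lemma threeAPCount_eq_apSum (S : Finset (ZMod p)) : (threeAPCount S : ℝ) = apSum (ind S) := by
  unfold threeAPCount apSum ind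
  rw [Finset.card_filter, Nat.cast_sum, ← Finset.univ_product_univ, Finset.sum_product]
  refine Finset.sum_congr rfl fun n _ => Finset.sum_congr rfl fun m _ => ?_
  by_cases h1 : n ∈ S <;> by_cases h2 : n + m ∈ S <;> by_cases h3 : n + 2 * m ∈ S <;>
    simp [h1, h2, h3]

lemma apSum_eq_apSumNT_add (f : ZMod p → ℝ) : apSum f = apSumNT f + ∑ n, f n ^ 3 := by
  unfold apSum apSumNT
  rw [← Finset.sum_add_distrib]
  refine Finset.sum_congr rfl fun n _ => ?_
  rw [← Finset.add_sum_erase univ _ (Finset.mem_univ (0 : ZMod p))]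
  simp only [add_zero, mul_zero]
  ring

lemma apSumNT_nonneg {f : ZMod p → ℝ} (h0 : ∀ x, 0 ≤ f x) : 0 ≤ apSumNT f :=
  Finset.sum_nonneg fun _ _ => Finset.sum_nonneg fun _ _ =>
    mul_nonneg (mul_nonneg (h0 _) (h0 _)) (h0 _)

lemma apSumNT_le_apSum {f : ZMod p → ℝ} (h0 : ∀ x, 0 ≤ f x) : apSumNT f ≤ apSum f := by
  rw [apSum_eq_apSumNT_add]
  have : 0 ≤ ∑ n, f n ^ 3 := Finset.sum_nonneg fun n _ => pow_nonneg (h0 n) 3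
  linarith

lemma apSum_le_apSumNT_add {f : ZMod p → ℝ} (h0 : ∀ x, 0 ≤ f x) (h1 : ∀ x, f x ≤ 1) :
    apSum f ≤ apSumNT f + p := by
  rw [apSum_eq_apSumNT_add]
  have : ∑ n, f n ^ 3 ≤ ∑ _n : ZMod p, (1 : ℝ) :=
    Finset.sum_le_sum fun n _ => pow_le_one₀ (h0 n) (h1 n)
  simp [ZMod.card] at this
  linarith

lemma apSum_le_sq {f : ZMod p → ℝ} (h0 : ∀ x, 0 ≤ f x) (h1 : ∀ x, f x ≤ 1) :
    apSum f ≤ (p : ℝ) ^ 2 := by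
  have : apSum f ≤ ∑ _n : ZMod p, ∑ _m : ZMod p, (1 : ℝ) :=
    Finset.sum_le_sum fun n _ => Finset.sum_le_sum fun m _ =>
      mul_le_one₀ (mul_le_one₀ (h1 _) (h0 _) (h1 _)) (h0 _) (h1 _)
  simp [ZMod.card] at this
  nlinarith

/-- Telescoping the product over its three positions, each position contributes at most `p` times
the added mass. -/
lemma apSumNT_le_add {h h' : ZMod p → ℝ} (h0 : ∀ x, 0 ≤ h x) (hle : ∀ x, h x ≤ h' x)
    (h1 : ∀ x, h' x ≤ 1) :
    apSumNT h' ≤ apSumNT h + 3 * p * ∑ x, (h' x - h x) := by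
  have key : apSumNT h' - apSumNT h ≤ ∑ n, ∑ m : ZMod p,
      ((h' n - h n) + (h' (n + m) - h (n + m)) + (h' (n + 2 * m) - h (n + 2 * m))) := by
    unfold apSumNT
    rw [← Finset.sum_sub_distrib]
    refine Finset.sum_le_sum fun n _ => ?_
    rw [← Finset.sum_sub_distrib]
    refine (Finset.sum_le_sum fun m _ => ?_).trans
      (Finset.sum_le_sum_of_subset_of_nonneg (Finset.erase_subset 0 univ) fun m _ _ => ?_)
    · have aux : ∀ a b c a' b' c' : ℝ, 0 ≤ a → 0 ≤ b → 0 ≤ c → a ≤ a' → b ≤ b' → c ≤ c' →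
          a' ≤ 1 → b' ≤ 1 → c' ≤ 1 →
          a' * b' * c' - a * b * c ≤ (a' - a) + (b' - b) + (c' - c) := by
        intro a b c a' b' c' ha hb hc haa hbb hcc ha' hb' hc'
        have e : a' * b' * c' - a * b * c =
          (a' - a) * (b' * c') + (b' - b) * (a * c') + (c' - c) * (a * b) := by ring
        have h1 : b' * c' ≤ 1 := mul_le_one₀ hb' (by linarith) hc'
        have h2 : a * c' ≤ 1 := mul_le_one₀ (by linarith) (by linarith) hc'
        have h3 : a * b ≤ 1 := mul_le_one₀ (by linarith) (by linarith) (by linarith)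
        have := mul_le_of_le_one_right (sub_nonneg.2 haa) h1
        have := mul_le_of_le_one_right (sub_nonneg.2 hbb) h2
        have := mul_le_of_le_one_right (sub_nonneg.2 hcc) h3
        linarith
      exact aux _ _ _ _ _ _ (h0 _) (h0 _) (h0 _) (hle _) (hle _) (hle _) (h1 _) (h1 _) (h1 _)
    · linarith [hle n, hle (n + m), hle (n + 2 * m)]
  have shift : ∀ b : ZMod p, ∑ n, (h' (n + b) - h (n + b)) = ∑ n, (h' n - h n) := fun b =>
    Equiv.sum_comp (Equiv.addRight b) fun n => h' n - h n
  rw [Finset.sum_comm] at key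
  simp only [Finset.sum_add_distrib, shift] at key
  simp only [Finset.sum_const, Finset.card_univ, ZMod.card, nsmul_eq_mul] at key
  linarith

end

/-! ### Rounding weights to sets -/

/-- The difference of the point masses at `x` and `y`. -/
def massShift {α : Type*} [DecidableEq α] (x y z : α) : ℝ :=
  (if z = x then 1 else 0) - (if z = y then 1 else 0)

section

variable {p : ℕ} [Fact p.Prime]

lemma two_ne_zero_zmod (hp : 2 < p) : (2 : ZMod p) ≠ 0 := by
  have : ((2 : ℕ) : ZMod p) ≠ 0 := by
    rw [Ne, ZMod.natCast_eq_zero_iff]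
    exact fun h => absurd (Nat.le_of_dvd two_pos h) (by omega)
  exact_mod_cast this

/-- Moving mass from `y` to `x` changes the count by a concave quadratic polynomial. -/
lemma apSumNT_add_massShift (hp : 2 < p) {h : ZMod p → ℝ} (h0 : ∀ x, 0 ≤ h x)
    {x y : ZMod p} (hxy : x ≠ y) :
    ∃ B C : ℝ, C ≤ 0 ∧ ∀ t : ℝ,
      apSumNT (fun z => h z + t * massShift x y z) = apSumNT h + B * t + C * t ^ 2 := by
  -- The terms of a nontrivial progression are distinct. Two distinct points carry opposite masses
  -- or a zero mass, and three cannot all lie in `{x, y}`: the quadratic coefficient is nonpositive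
  -- and the cubic one vanishes.
  have hv2 : ∀ a b : ZMod p, a ≠ b → massShift x y a * massShift x y b ≤ 0 := by
    intro a b hab
    unfold massShift
    have := hxy
    split_ifs <;> simp_all
  have hv3 : ∀ a b c : ZMod p, a ≠ b → b ≠ c → a ≠ c →
      massShift x y a * massShift x y b * massShift x y c = 0 := by
    intro a b c hab hbc hac
    unfold massShift
    have := hxy
    split_ifs <;> simp_all
  have h2 := two_ne_zero_zmod hp
  set v := massShift x y
  refine ⟨∑ n, ∑ m ∈ univ.erase (0 : ZMod p), (v n * h (n + m) * h (n + 2 * m) +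
      h n * v (n + m) * h (n + 2 * m) + h n * h (n + m) * v (n + 2 * m)),
    ∑ n, ∑ m ∈ univ.erase (0 : ZMod p), (v n * v (n + m) * h (n + 2 * m) +
      v (n + m) * v (n + 2 * m) * h n + v n * v (n + 2 * m) * h (n + m)), ?_, ?_⟩
  · refine Finset.sum_nonpos fun n _ => Finset.sum_nonpos fun m hm => ?_
    have hm0 := (Finset.mem_erase.1 hm).1
    have d1 : n ≠ n + m := by simpa using hm0
    have d2 : n + m ≠ n + 2 * m := by
      intro h; apply hm0; linear_combination -h
    have d3 : n ≠ n + 2 * m := by simpa using ⟨h2, hm0⟩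
    have := mul_nonpos_of_nonpos_of_nonneg (hv2 _ _ d1) (h0 (n + 2 * m))
    have := mul_nonpos_of_nonpos_of_nonneg (hv2 _ _ d2) (h0 n)
    have := mul_nonpos_of_nonpos_of_nonneg (hv2 _ _ d3) (h0 (n + m))
    linarith
  · intro t
    unfold apSumNT
    rw [Finset.sum_mul, Finset.sum_mul, ← Finset.sum_add_distrib, ← Finset.sum_add_distrib]
    refine Finset.sum_congr rfl fun n _ => ?_
    rw [Finset.sum_mul, Finset.sum_mul, ← Finset.sum_add_distrib, ← Finset.sum_add_distrib]
    refine Finset.sum_congr rfl fun m hm => ?_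
    have hm0 := (Finset.mem_erase.1 hm).1
    have d1 : n ≠ n + m := by simpa using hm0
    have d2 : n + m ≠ n + 2 * m := by
      intro h; apply hm0; linear_combination -h
    have d3 : n ≠ n + 2 * m := by simpa using ⟨h2, hm0⟩
    linear_combination t ^ 3 * hv3 _ _ _ d1 d2 d3

/-- By concavity, it suffices to move to the end of the interval towards which the linear term does
not increase. -/
lemma exists_massShift_le (hp : 2 < p) {h : ZMod p → ℝ} (h0 : ∀ x, 0 ≤ h x)
    {x y : ZMod p} (hxy : x ≠ y) {t₁ t₂ : ℝ} (ht₁ : 0 ≤ t₁) (ht₂ : 0 ≤ t₂) :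
    ∃ t : ℝ, (t = t₂ ∨ t = -t₁) ∧
      apSumNT (fun z => h z + t * massShift x y z) ≤ apSumNT h := by
  obtain ⟨B, C, hC, hq⟩ := apSumNT_add_massShift hp h0 hxy
  rcases le_total B 0 with hB | hB
  · refine ⟨t₂, Or.inl rfl, ?_⟩
    rw [hq]
    nlinarith [mul_nonneg (neg_nonneg.2 hB) ht₂, mul_nonneg (neg_nonneg.2 hC) (sq_nonneg t₂)]
  · refine ⟨-t₁, Or.inr rfl, ?_⟩
    rw [hq]
    nlinarith [mul_nonneg hB ht₁, mul_nonneg (neg_nonneg.2 hC) (sq_nonneg t₁)]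

/-- Deterministic rounding of a `[0, 1]`-valued function to a set. -/
lemma exists_finset_rounding (hp : 2 < p) (h : ZMod p → ℝ) (h0 : ∀ x, 0 ≤ h x)
    (h1 : ∀ x, h x ≤ 1) :
    ∃ T : Finset (ZMod p), ∑ x, h x ≤ T.card ∧ apSumNT (ind T) ≤ apSumNT h + 3 * p := by
  classical
  -- Induction on the number of points with a fractional value.
  induction hn : (univ.filter fun x => h x ≠ 0 ∧ h x ≠ 1).card using Nat.strong_induction_on
    generalizing h with
  | _ n ih =>
  rcases le_or_gt n 1 with hn1 | hn1
  -- At most one fractional value is left; rounding it up costs at most `3 p`.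
  · refine ⟨univ.filter fun x => h x ≠ 0, ?_, ?_⟩
    · rw [← sum_ind]
      refine Finset.sum_le_sum fun x _ => ?_
      by_cases hx : h x = 0
      · simp [ind, hx]
      · simpa [ind, hx] using h1 x
    · have hle : ∀ x, h x ≤ ind (univ.filter fun x => h x ≠ 0) x := fun x => by
        by_cases hx : h x = 0
        · simp [ind, hx]
        · simpa [ind, hx] using h1 x
      have hs : ∑ x, (ind (univ.filter fun x => h x ≠ 0) x - h x) ≤
          ∑ x, ind (univ.filter fun x => h x ≠ 0 ∧ h x ≠ 1) x := by
        refine Finset.sum_le_sum fun x _ => ?_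
        by_cases hx : h x = 0
        · simp [ind, hx]
        · by_cases hx1 : h x = 1
          · simp [ind, hx1]
          · simpa [ind, hx, hx1] using h0 x
      rw [sum_ind, hn] at hs
      have hs1 : (n : ℝ) ≤ 1 := by exact_mod_cast hn1
      have := apSumNT_le_add h0 hle (fun x => ind_le_one _ x)
      have hp0 : (0 : ℝ) ≤ 3 * p := by positivity
      nlinarith
  · rw [← hn] at hn1
    obtain ⟨x, hx, y, hy, hxy⟩ := Finset.one_lt_card.1 hn1
    have hx' := (Finset.mem_filter.1 hx).2
    have hy' := (Finset.mem_filter.1 hy).2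
    -- These are the largest moves that keep both values in `[0, 1]`, so either end makes one of
    -- them `0` or `1`.
    obtain ⟨t, ht, hle⟩ := exists_massShift_le hp h0 hxy
      (t₁ := min (h x) (1 - h y)) (t₂ := min (1 - h x) (h y))
      (le_min (h0 x) (by linarith [h1 y])) (le_min (by linarith [h1 x]) (h0 y))
    have hvx : massShift x y x = 1 := by simp [massShift, hxy]
    have hvy : massShift x y y = -1 := by simp [massShift, hxy.symm]
    have hvz : ∀ z, z ≠ x → z ≠ y → massShift x y z = 0 := fun z h1 h2 => by
      simp [massShift, h1, h2]
    have hb : (0 ≤ h x + t ∧ h x + t ≤ 1) ∧ (0 ≤ h y - t ∧ h y - t ≤ 1) ∧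
        ((h x + t = 0 ∨ h x + t = 1) ∨ (h y - t = 0 ∨ h y - t = 1)) := by
      have := h0 x; have := h0 y; have := h1 x; have := h1 y
      rcases ht with rfl | rfl
      · rcases min_cases (1 - h x) (h y) with ⟨e, _⟩ | ⟨e, _⟩ <;> rw [e] <;>
          refine ⟨⟨?_, ?_⟩, ⟨?_, ?_⟩, ?_⟩ <;> first | linarith | simp
      · rcases min_cases (h x) (1 - h y) with ⟨e, _⟩ | ⟨e, _⟩ <;> rw [e] <;>
          refine ⟨⟨?_, ?_⟩, ⟨?_, ?_⟩, ?_⟩ <;> first | linarith | simp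
    obtain ⟨⟨hx0, hx1⟩, ⟨hy0, hy1⟩, hint⟩ := hb
    have hbd : ∀ z, 0 ≤ h z + t * massShift x y z ∧ h z + t * massShift x y z ≤ 1 := by
      intro z
      by_cases hzx : z = x
      · subst hzx; rw [hvx, mul_one]; exact ⟨hx0, hx1⟩
      by_cases hzy : z = y
      · subst hzy; rw [hvy, mul_neg_one]; exact ⟨hy0, hy1⟩
      · rw [hvz z hzx hzy, mul_zero, add_zero]; exact ⟨h0 z, h1 z⟩
    have hsum : ∑ z, (h z + t * massShift x y z) = ∑ z, h z := by
      rw [Finset.sum_add_distrib, ← Finset.mul_sum]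
      simp [massShift]
    have hlt : (univ.filter fun z => h z + t * massShift x y z ≠ 0 ∧
        h z + t * massShift x y z ≠ 1).card < n := by
      rw [← hn]
      apply Finset.card_lt_card
      refine ⟨fun z hz => ?_, fun hsub => ?_⟩
      · by_cases hzx : z = x
        · rwa [hzx]
        by_cases hzy : z = y
        · rwa [hzy]
        · simpa [hvz z hzx hzy] using hz
      · have ax := (Finset.mem_filter.1 (hsub hx)).2
        have ay := (Finset.mem_filter.1 (hsub hy)).2
        rw [hvx, mul_one] at ax
        rw [hvy, mul_neg_one, ← sub_eq_add_neg] at ay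
        tauto
    obtain ⟨T, hT1, hT2⟩ := ih _ hlt (fun z => h z + t * massShift x y z)
      (fun z => (hbd z).1) (fun z => (hbd z).2) rfl
    exact ⟨T, hsum ▸ hT1, hT2.trans (by linarith)⟩

end

/-! ### Random affine copies of a set with few progressions -/

section

variable {p : ℕ} [Fact p.Prime]

lemma sum_comp_mul_right {m : ZMod p} (hm : m ≠ 0) (φ : ZMod p → ℝ) :
    ∑ y, φ (y * m) = ∑ y, φ y :=
  Equiv.sum_comp (Equiv.mulRight₀ m hm) φ

lemma sum_erase_zero_comp_mul_right {m : ZMod p} (hm : m ≠ 0) (φ : ZMod p → ℝ) :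
    ∑ y ∈ univ.erase (0 : ZMod p), φ (y * m) = ∑ y ∈ univ.erase (0 : ZMod p), φ y := by
  have h := sum_comp_mul_right hm φ
  rw [← Finset.add_sum_erase univ _ (Finset.mem_univ (0 : ZMod p)),
    ← Finset.add_sum_erase univ φ (Finset.mem_univ (0 : ZMod p)), zero_mul] at h
  exact add_left_cancel h

/-- An invertible affine map sends a pair (point, nonzero difference) to a uniformly distributed
such pair. -/
lemma sum_affine (n : ZMod p) {m : ZMod p} (hm : m ≠ 0) (φ : ZMod p → ZMod p → ℝ) :
    ∑ r ∈ univ.erase (0 : ZMod p), ∑ s, φ (r * n + s) (r * m) =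
      ∑ y ∈ univ.erase (0 : ZMod p), ∑ x, φ x y := by
  rw [← sum_erase_zero_comp_mul_right hm fun y => ∑ x, φ x y]
  exact Finset.sum_congr rfl fun r _ =>
    Equiv.sum_comp (Equiv.addLeft (r * n)) fun x => φ x (r * m)

/-- A fixed nontrivial progression is carried to a uniformly distributed one by a random affine map,
so the expected product factors. -/
lemma sum_apSumNT_affine (g w : ZMod p → ℝ) :
    ∑ r ∈ univ.erase (0 : ZMod p), ∑ s, apSumNT (fun n => g n * w (r * n + s)) =
      apSumNT g * apSumNT w := by
  have hw : apSumNT w = ∑ y ∈ univ.erase (0 : ZMod p), ∑ x, w x * w (x + y) * w (x + 2 * y) := by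
    unfold apSumNT
    rw [Finset.sum_comm]
  calc _ = ∑ r ∈ univ.erase (0 : ZMod p), ∑ n, ∑ s, ∑ m ∈ univ.erase (0 : ZMod p),
        g n * w (r * n + s) * (g (n + m) * w (r * (n + m) + s)) *
          (g (n + 2 * m) * w (r * (n + 2 * m) + s)) :=
        Finset.sum_congr rfl fun r _ => Finset.sum_comm
    _ = ∑ n, ∑ r ∈ univ.erase (0 : ZMod p), ∑ s, ∑ m ∈ univ.erase (0 : ZMod p),
        g n * w (r * n + s) * (g (n + m) * w (r * (n + m) + s)) *
          (g (n + 2 * m) * w (r * (n + 2 * m) + s)) := Finset.sum_comm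
    _ = ∑ n, ∑ r ∈ univ.erase (0 : ZMod p), ∑ m ∈ univ.erase (0 : ZMod p), ∑ s,
        g n * w (r * n + s) * (g (n + m) * w (r * (n + m) + s)) *
          (g (n + 2 * m) * w (r * (n + 2 * m) + s)) :=
        Finset.sum_congr rfl fun n _ => Finset.sum_congr rfl fun r _ => Finset.sum_comm
    _ = ∑ n, ∑ m ∈ univ.erase (0 : ZMod p), ∑ r ∈ univ.erase (0 : ZMod p), ∑ s,
        g n * w (r * n + s) * (g (n + m) * w (r * (n + m) + s)) *
          (g (n + 2 * m) * w (r * (n + 2 * m) + s)) :=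
        Finset.sum_congr rfl fun n _ => Finset.sum_comm
    _ = _ := by
      conv_rhs => rw [apSumNT]
      rw [Finset.sum_mul]
      refine Finset.sum_congr rfl fun n _ => ?_
      rw [Finset.sum_mul]
      refine Finset.sum_congr rfl fun m hm => ?_
      rw [hw, ← sum_affine n (Finset.ne_of_mem_erase hm)
        fun x y => w x * w (x + y) * w (x + 2 * y), Finset.mul_sum]
      refine Finset.sum_congr rfl fun r _ => ?_
      rw [Finset.mul_sum]
      refine Finset.sum_congr rfl fun s _ => ?_
      rw [show r * (n + m) + s = r * n + s + r * m by ring,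
        show r * (n + 2 * m) + s = r * n + s + 2 * (r * m) by ring]
      ring

/-- Second moment of the mean-zero function `v`, moved by a random affine map and tested
against `g`. -/
lemma sum_sq_affine_le {g v : ZMod p → ℝ} (g0 : ∀ x, 0 ≤ g x) (g1 : ∀ x, g x ≤ 1)
    (hv : ∑ x, v x = 0) (v1 : ∀ x, |v x| ≤ 1) :
    ∑ r ∈ univ.erase (0 : ZMod p), ∑ s, (∑ n, g n * v (r * n + s)) ^ 2 ≤
      (p - 1 : ℝ) * p * p := by
  have hcard : ((univ.erase (0 : ZMod p)).card : ℝ) = p - 1 := by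
    rw [Finset.card_erase_of_mem (Finset.mem_univ _), Finset.card_univ, ZMod.card,
      Nat.cast_sub (Fact.out : p.Prime).one_le, Nat.cast_one]
  have hp1 : (0 : ℝ) ≤ p - 1 := by rw [← hcard]; positivity
  have hpair : ∀ n n' : ZMod p,
      ∑ r ∈ univ.erase (0 : ZMod p), ∑ s, v (r * n + s) * v (r * n' + s) ≤
        if n = n' then (p - 1 : ℝ) * p else 0 := by
    intro n n'
    split_ifs with h
    · subst h
      calc _ ≤ ∑ _r ∈ univ.erase (0 : ZMod p), ∑ _s : ZMod p, (1 : ℝ) := by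
            refine Finset.sum_le_sum fun r _ => Finset.sum_le_sum fun s _ => ?_
            rw [← abs_mul_abs_self]
            exact mul_le_one₀ (v1 _) (abs_nonneg _) (v1 _)
        _ = _ := by
          rw [Finset.sum_const, nsmul_eq_mul, hcard]
          simp [ZMod.card]
    -- Over all differences the correlations of `v` sum to zero, since `v` has mean zero. Omitting
    -- the difference `0` removes a sum of squares, so the rest is nonpositive.
    · have hm : n' - n ≠ 0 := sub_ne_zero.2 (Ne.symm h)
      have e := sum_affine n hm fun x y => v x * v (x + y)
      have e1 : ∑ r ∈ univ.erase (0 : ZMod p), ∑ s, v (r * n + s) * v (r * n' + s) =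
          ∑ y ∈ univ.erase (0 : ZMod p), ∑ x, v x * v (x + y) := by
        rw [← e]
        refine Finset.sum_congr rfl fun r _ => Finset.sum_congr rfl fun s _ => ?_
        rw [show r * n + s + r * (n' - n) = r * n' + s by ring]
      rw [e1]
      have e2 : ∑ y, ∑ x, v x * v (x + y) = 0 := by
        rw [Finset.sum_comm]
        refine Finset.sum_eq_zero fun x _ => ?_
        have hs : ∑ y, v (x + y) = 0 := (Equiv.sum_comp (Equiv.addLeft x) v).trans hv
        rw [← Finset.mul_sum, hs, mul_zero]
      rw [← Finset.add_sum_erase univ _ (Finset.mem_univ (0 : ZMod p))] at e2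
      have e3 : 0 ≤ ∑ x, v x * v (x + 0) :=
        Finset.sum_nonneg fun x _ => by rw [add_zero]; exact mul_self_nonneg _
      linarith
  calc _ = ∑ n, ∑ n', g n * g n' *
        ∑ r ∈ univ.erase (0 : ZMod p), ∑ s, v (r * n + s) * v (r * n' + s) := by
        have hsq : ∀ r s : ZMod p, (∑ n, g n * v (r * n + s)) ^ 2 =
            ∑ n, ∑ n', g n * g n' * (v (r * n + s) * v (r * n' + s)) := fun r s => by
          rw [sq, Finset.sum_mul_sum]
          refine Finset.sum_congr rfl fun n _ => Finset.sum_congr rfl fun n' _ => ?_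
          ring
        simp only [hsq, Finset.mul_sum]
        rw [Finset.sum_congr rfl fun r _ => Finset.sum_comm, Finset.sum_comm]
        refine Finset.sum_congr rfl fun n _ => ?_
        rw [Finset.sum_congr rfl fun r _ => Finset.sum_comm, Finset.sum_comm]
    _ ≤ ∑ n : ZMod p, ∑ n' : ZMod p, if n = n' then (p - 1 : ℝ) * p else 0 := by
        refine Finset.sum_le_sum fun n _ => Finset.sum_le_sum fun n' _ => ?_
        refine (mul_le_mul_of_nonneg_left (hpair n n') (mul_nonneg (g0 n) (g0 n'))).trans ?_
        refine mul_le_of_le_one_left ?_ (mul_le_one₀ (g1 n) (g0 n') (g1 n'))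
        split_ifs
        · positivity
        · exact le_rfl
    _ = _ := by
        simp [ZMod.card]
        ring

/-- Inclusion–exclusion: any two terms of a progression determine it freely because `2` is
invertible, so only the cubic term depends on more than the mass of `u`. -/
lemma apSum_one_sub (hp : 2 < p) (u : ZMod p → ℝ) :
    apSum (fun x => 1 - u x) =
      (p : ℝ) ^ 2 - 3 * (∑ x, u x) * p + 3 * (∑ x, u x) ^ 2 - apSum u := by
  have h2 := two_ne_zero_zmod hp
  have shift : ∀ b : ZMod p, ∑ n, u (n + b) = ∑ n, u n := fun b =>
    Equiv.sum_comp (Equiv.addRight b) u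
  have shift' : ∀ b : ZMod p, ∑ n, u (b + n) = ∑ n, u n := fun b =>
    Equiv.sum_comp (Equiv.addLeft b) u
  have a1 : ∑ n : ZMod p, ∑ _m : ZMod p, u n = (∑ x, u x) * p := by
    simp only [Finset.sum_const, Finset.card_univ, ZMod.card, nsmul_eq_mul]
    rw [← Finset.mul_sum, mul_comm]
  have a2 : ∑ n : ZMod p, ∑ m : ZMod p, u (n + m) = (∑ x, u x) * p := by
    simp only [shift', Finset.sum_const, Finset.card_univ, ZMod.card, nsmul_eq_mul, mul_comm]
  have a3 : ∑ n : ZMod p, ∑ m : ZMod p, u (n + 2 * m) = (∑ x, u x) * p := by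
    rw [Finset.sum_comm]
    simp only [shift, Finset.sum_const, Finset.card_univ, ZMod.card, nsmul_eq_mul, mul_comm]
  have b1 : ∑ n : ZMod p, ∑ m : ZMod p, u n * u (n + m) = (∑ x, u x) ^ 2 := by
    simp only [← Finset.mul_sum, shift', ← Finset.sum_mul, sq]
  have b2 : ∑ n : ZMod p, ∑ m : ZMod p, u n * u (n + 2 * m) = (∑ x, u x) ^ 2 := by
    have : ∀ n, ∑ m : ZMod p, u (n + 2 * m) = ∑ m, u m := fun n => by
      rw [← shift' n, ← sum_comp_mul_right h2 fun m => u (n + m)]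
      simp only [mul_comm]
    simp only [← Finset.mul_sum, this, ← Finset.sum_mul, sq]
  have b3 : ∑ n : ZMod p, ∑ m : ZMod p, u (n + m) * u (n + 2 * m) = (∑ x, u x) ^ 2 := by
    rw [← b1, Finset.sum_comm]
    conv_rhs => rw [Finset.sum_comm]
    refine Finset.sum_congr rfl fun m _ => ?_
    rw [← Equiv.sum_comp (Equiv.addRight m) fun n => u n * u (n + m)]
    refine Finset.sum_congr rfl fun n _ => ?_
    simp only [Equiv.coe_addRight]
    rw [show n + m + m = n + 2 * m by ring]
  have c : ∑ _n : ZMod p, ∑ _m : ZMod p, (1 : ℝ) = (p : ℝ) ^ 2 := by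
    simp [ZMod.card, sq]
  have e : apSum (fun x => 1 - u x) = ∑ n : ZMod p, ∑ m : ZMod p,
      (1 - u n - u (n + m) - u (n + 2 * m) + u n * u (n + m) + u n * u (n + 2 * m) +
        u (n + m) * u (n + 2 * m) - u n * u (n + m) * u (n + 2 * m)) := by
    unfold apSum
    refine Finset.sum_congr rfl fun n _ => Finset.sum_congr rfl fun m _ => ?_
    ring
  rw [e]
  simp only [Finset.sum_add_distrib, Finset.sum_sub_distrib, a1, a2, a3, b1, b2, b3, c]
  unfold apSum
  ring

lemma natCast_injOn_range {l : ℕ} (hl : l ≤ p) :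
    Set.InjOn (fun i : ℕ => (i : ZMod p)) (Finset.range l) := by
  intro i hi j hj hij
  simp only [Finset.coe_range, Set.mem_Iio] at hi hj
  have := (ZMod.natCast_eq_natCast_iff' i j p).1 hij
  rwa [Nat.mod_eq_of_lt (by omega), Nat.mod_eq_of_lt (by omega)] at this

lemma sq_le_apSum_interval {q : ℕ} (hq : 3 * q ≤ p) :
    (q : ℝ) ^ 2 ≤ apSum (ind ((Finset.range (3 * q)).image fun i : ℕ => (i : ZMod p))) := by
  rw [← threeAPCount_eq_apSum]
  have hinj := natCast_injOn_range (p := p) hq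
  have : q ^ 2 ≤ threeAPCount ((Finset.range (3 * q)).image fun i : ℕ => (i : ZMod p)) := by
    calc q ^ 2 = (Finset.range q ×ˢ Finset.range q).card := by simp [sq]
      _ = ((Finset.range q ×ˢ Finset.range q).image
            fun x : ℕ × ℕ => ((x.1 : ZMod p), (x.2 : ZMod p))).card := by
          rw [Finset.card_image_of_injOn]
          rintro ⟨i, j⟩ hi ⟨i', j'⟩ hi' h
          simp only [Finset.coe_product, Finset.coe_range, Set.mem_prod, Set.mem_Iio] at hi hi'
          simp only [Prod.mk.injEq] at h ⊢
          exact ⟨hinj (by simp; omega) (by simp; omega) h.1,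
            hinj (by simp; omega) (by simp; omega) h.2⟩
      _ ≤ _ := by
          apply Finset.card_le_card
          intro x hx
          simp only [Finset.mem_image, Finset.mem_product, Finset.mem_range, Prod.exists] at hx
          obtain ⟨i, j, ⟨hi, hj⟩, rfl⟩ := hx
          simp only [Finset.mem_filter, Finset.mem_univ, true_and, Finset.mem_image,
            Finset.mem_range]
          exact ⟨⟨i, by omega, rfl⟩, ⟨i + j, by omega, by push_cast; rfl⟩,
            ⟨i + 2 * j, by omega, by push_cast; rfl⟩⟩
  exact_mod_cast this

/-- There is a set of density `1 - x` with noticeably fewer than the expected number of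
progressions. -/
lemma exists_finset_few_ap (hp : 2 < p) {q : ℕ} (hq : 54 * q ≤ p) :
    ∃ W : Finset (ZMod p), (W.card : ℝ) = p - 3 * q ∧
      apSumNT (ind W) ≤ (p : ℝ) ^ 2 * ((1 - 3 * q / p) ^ 3 * (1 - (3 * q / p) ^ 2 / 18)) := by
  -- An interval is rich in progressions, at least `x² p² / 9` against the random `x³ p²`; by
  -- inclusion–exclusion its complement is poor in them.
  set U := (Finset.range (3 * q)).image fun i : ℕ => (i : ZMod p) with hU
  have hUc : U.card = 3 * q := by
    rw [hU, Finset.card_image_of_injOn (natCast_injOn_range (by omega)), Finset.card_range]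
  have hp0 : (0 : ℝ) < p := by exact_mod_cast (by omega : 0 < p)
  refine ⟨Uᶜ, ?_, ?_⟩
  · rw [Finset.card_compl, hUc, ZMod.card, Nat.cast_sub (by omega)]
    push_cast; ring
  · have e : ind Uᶜ = fun x => 1 - ind U x := by
      funext x
      by_cases hx : x ∈ U <;> simp [ind, hx]
    have h1 := apSum_one_sub hp (ind U)
    rw [← e, sum_ind, hUc] at h1
    push_cast at h1
    have h2 := sq_le_apSum_interval (p := p) (q := q) (by omega)
    refine (apSumNT_le_apSum (ind_nonneg _)).trans ?_
    have hx : (3 * q / p : ℝ) ≤ 1 / 18 := by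
      rw [div_le_div_iff₀ hp0 (by norm_num)]
      have : (54 * q : ℝ) ≤ p := by exact_mod_cast hq
      linarith
    have hx0 : (0 : ℝ) ≤ 3 * q / p := by positivity
    set x : ℝ := 3 * q / p with hxd
    have hq' : (q : ℝ) = x * p / 3 := by rw [hxd]; field_simp
    -- Here `x ≤ 1 / 18` gives `x³ ≤ x² / 18`, leaving half of the gain `x² / 9`.
    have hpoly : 1 - 3 * x + 3 * x ^ 2 - x ^ 2 / 9 ≤ (1 - x) ^ 3 * (1 - x ^ 2 / 18) := by
      have : (1 - x) ^ 3 ≤ 1 := pow_le_one₀ (by linarith) (by linarith)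
      have a := mul_le_mul_of_nonneg_left this (by positivity : 0 ≤ x ^ 2 / 18)
      nlinarith [mul_nonneg (sq_nonneg x) (sub_nonneg.2 hx)]
    have := mul_le_mul_of_nonneg_left hpoly (sq_nonneg (p : ℝ))
    rw [hq'] at h1 h2
    change apSum (ind U) ≥ _ at h2
    nlinarith

/-- Arbitrary points make up the deficit; the `+ 1` pays for rounding `σ` up. -/
lemma exists_finset_card_ge {T : Finset (ZMod p)} {σ D : ℝ} (hσ : σ ≤ p) (hD : 0 ≤ D)
    (hT : σ - D ≤ T.card) :
    ∃ T' : Finset (ZMod p), σ ≤ T'.card ∧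
      apSumNT (ind T') ≤ apSumNT (ind T) + 3 * p * (D + 1) := by
  have hTp : T.card ≤ p := by simpa [ZMod.card] using Finset.card_le_univ T
  have hσn : ⌈σ⌉₊ ≤ p := Nat.ceil_le.2 hσ
  obtain ⟨T', hsub, hc⟩ := Finset.exists_superset_card_eq (s := T) (n := max T.card ⌈σ⌉₊)
    (le_max_left _ _) (by rw [ZMod.card]; exact max_le hTp hσn)
  have hle : ∀ x, ind T x ≤ ind T' x := by
    intro x
    by_cases hx : x ∈ T
    · simp [ind, hx, hsub hx]
    · simpa [ind, hx] using ind_nonneg T' x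
  refine ⟨T', (Nat.le_ceil σ).trans ?_, (apSumNT_le_add (ind_nonneg T) hle (ind_le_one T')).trans ?_⟩
  · rw [hc]; exact_mod_cast le_max_right _ _
  · rw [Finset.sum_sub_distrib, sum_ind, sum_ind, hc]
    gcongr
    push_cast
    rcases max_cases (T.card : ℝ) (⌈σ⌉₊ : ℝ) with ⟨e, _⟩ | ⟨e, h⟩
    · rw [e]; linarith
    · rw [e]
      have hpos : 0 < σ := by
        by_contra hn
        rw [Nat.ceil_eq_zero.2 (not_lt.1 hn)] at h
        have : (0 : ℝ) ≤ T.card := by positivity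
        push_cast at h; linarith
      linarith [Nat.ceil_lt_add_one hpos.le]

/-- AM–GM, weighted so that both terms agree when `D ^ 2 = x`. It trades the absolute value for a
square, which the second moment controls. -/
lemma three_mul_abs_le {x : ℝ} (hx : 0 < x) (D : ℝ) :
    3 * x * |D| ≤ 3 / 2 * x * √x + 3 / 2 * x / √x * D ^ 2 := by
  have hs : 0 < √x := Real.sqrt_pos.2 hx
  have h' : 2 * √x * |D| ≤ √x * √x + D ^ 2 := by
    nlinarith [sq_abs D, sq_nonneg (√x - |D|)]
  calc 3 * x * |D| = 3 / 2 * x / √x * (2 * √x * |D|) := by field_simp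
    _ ≤ 3 / 2 * x / √x * (√x * √x + D ^ 2) := by gcongr
    _ = _ := by field_simp

/-- A function bounded away from `1` is far from minimizing the number of progressions among sets
of the same density. -/
theorem exists_finset_fewer_ap (hp : 2 < p) {q : ℕ} (hq : 54 * q ≤ p) {g : ZMod p → ℝ}
    (g0 : ∀ x, 0 ≤ g x) (g1 : ∀ x, g x ≤ 1 - 3 * q / p) :
    ∃ T : Finset (ZMod p), ∑ x, g x ≤ T.card ∧
      apSumNT (ind T) ≤ apSumNT g * (1 - (3 * q / p) ^ 2 / 18) + 8 * p + 3 * p * √p := by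
  obtain ⟨W, hWc, hW⟩ := exists_finset_few_ap hp hq
  have hp0 : (0 : ℝ) < p := by exact_mod_cast (by omega : 0 < p)
  have hp2 : (2 : ℝ) < p := by exact_mod_cast hp
  have hx : (3 * q / p : ℝ) ≤ 1 / 18 := by
    rw [div_le_div_iff₀ hp0 (by norm_num)]
    have : (54 * q : ℝ) ≤ p := by exact_mod_cast hq
    linarith
  have hx0 : (0 : ℝ) ≤ 3 * q / p := by positivity
  set x : ℝ := 3 * q / p with hxd
  have hWx : (W.card : ℝ) = p * (1 - x) := by
    rw [hWc, hxd]; field_simp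
  have hx1 : 0 < 1 - x := by linarith
  -- Rescaling by `c` gives `W` mean one, and `g ≤ 1 - x = c⁻¹` keeps the product at most `1`.
  set c : ℝ := (1 - x)⁻¹ with hc
  have hc0 : 0 < c := inv_pos.2 hx1
  have hc2 : c ≤ 2 := by
    rw [hc, inv_le_comm₀ hx1 two_pos]; linarith
  have hcx : c * (1 - x) = 1 := inv_mul_cancel₀ hx1.ne'
  have gle1 : ∀ y, g y ≤ 1 := fun y => (g1 y).trans (by linarith)
  have hcard : ((univ.erase (0 : ZMod p)).card : ℝ) = p - 1 := by
    rw [Finset.card_erase_of_mem (Finset.mem_univ _), Finset.card_univ, ZMod.card,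
      Nat.cast_sub (Fact.out : p.Prime).one_le, Nat.cast_one]
  have hv0 : ∑ y, (c * ind W y - 1) = 0 := by
    rw [Finset.sum_sub_distrib, ← Finset.mul_sum, sum_ind, hWx]
    simp only [Finset.sum_const, Finset.card_univ, ZMod.card, nsmul_eq_mul, mul_one]
    linear_combination (p : ℝ) * hcx
  have hv1 : ∀ y, |c * ind W y - 1| ≤ 1 := fun y => by
    rw [abs_le]
    have h1 := mul_nonneg hc0.le (ind_nonneg W y)
    have h2 := mul_le_mul_of_nonneg_left (ind_le_one W y) hc0.le
    constructor <;> linarith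
  have hvar := sum_sq_affine_le g0 gle1 hv0 hv1
  have hap := sum_apSumNT_affine g (fun y => c * ind W y)
  have hapc : apSumNT (fun y => c * ind W y) = c ^ 3 * apSumNT (ind W) := by
    unfold apSumNT
    simp only [Finset.mul_sum]
    refine Finset.sum_congr rfl fun n _ => Finset.sum_congr rfl fun m _ => ?_
    ring
  have hWle : apSumNT (fun y => c * ind W y) ≤ (p : ℝ) ^ 2 * (1 - x ^ 2 / 18) := by
    rw [hapc]
    calc _ ≤ c ^ 3 * ((p : ℝ) ^ 2 * ((1 - x) ^ 3 * (1 - x ^ 2 / 18))) := by gcongr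
      _ = (c * (1 - x)) ^ 3 * ((p : ℝ) ^ 2 * (1 - x ^ 2 / 18)) := by ring
      _ = _ := by rw [hcx]; ring
  have hG0 := apSumNT_nonneg g0
  have hGp : apSumNT g ≤ (p : ℝ) ^ 2 := (apSumNT_le_apSum g0).trans (apSum_le_sq g0 gle1)
  have hsp : 0 < √(p : ℝ) := Real.sqrt_pos.2 hp0
  have hspsq : √(p : ℝ) * √(p : ℝ) = p := Real.mul_self_sqrt hp0.le
  set X : ZMod p → ZMod p → ℝ := fun r s =>
    apSumNT (fun n => g n * (c * ind W (r * n + s))) with hX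
  set D : ZMod p → ZMod p → ℝ := fun r s => ∑ n, g n * (c * ind W (r * n + s) - 1) with hD
  -- Adding the squared mass defect as a penalty lets one pair `(r, s)` serve both purposes; the
  -- weight is that of `three_mul_abs_le`.
  have hmain : ∑ rs ∈ univ.erase (0 : ZMod p) ×ˢ (univ : Finset (ZMod p)),
      (X rs.1 rs.2 + 3 / 2 * p / √p * D rs.1 rs.2 ^ 2) ≤
      ∑ _rs ∈ univ.erase (0 : ZMod p) ×ˢ (univ : Finset (ZMod p)),
        (apSumNT g * (1 - x ^ 2 / 18) + 2 * p + 3 / 2 * p * √p) := by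
    rw [Finset.sum_const, Finset.card_product, nsmul_eq_mul, Nat.cast_mul, hcard,
      Finset.card_univ, ZMod.card, Finset.sum_product]
    simp only [Finset.sum_add_distrib, ← Finset.mul_sum]
    -- The average runs over `p (p - 1)` maps rather than `p²`, which costs at most `2 p`.
    have h1 : ∑ r ∈ univ.erase (0 : ZMod p), ∑ s, X r s ≤
        (p - 1) * p * (apSumNT g * (1 - x ^ 2 / 18) + 2 * p) := by
      rw [hX, hap]
      have hy : 0 ≤ 1 - x ^ 2 / 18 := by nlinarith
      have hy1 : 1 - x ^ 2 / 18 ≤ 1 := by nlinarith [sq_nonneg x]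
      calc _ ≤ apSumNT g * ((p : ℝ) ^ 2 * (1 - x ^ 2 / 18)) := by gcongr
        _ = (p - 1) * p * (apSumNT g * (1 - x ^ 2 / 18)) +
            p * (apSumNT g * (1 - x ^ 2 / 18)) := by ring
        _ ≤ (p - 1) * p * (apSumNT g * (1 - x ^ 2 / 18)) + p * ((p : ℝ) ^ 2 * 1) := by gcongr
        _ ≤ _ := by nlinarith [mul_pos hp0 hp0]
    have h2 : 3 / 2 * p / √p * ∑ r ∈ univ.erase (0 : ZMod p), ∑ s, D r s ^ 2 ≤
        (p - 1) * p * (3 / 2 * p * √p) := by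
      calc _ ≤ 3 / 2 * p / √p * ((p - 1 : ℝ) * p * p) := by gcongr
        _ = (p - 1) * p * (3 / 2 * p * √p) := by
          rw [div_mul_eq_mul_div, div_eq_iff hsp.ne']
          linear_combination (-(3 / 2 * (p : ℝ) ^ 2 * (p - 1))) * hspsq
    linarith
  obtain ⟨⟨r, s⟩, hrs, hle⟩ := Finset.exists_le_of_sum_le
    (⟨(1, 0), by simp⟩ : (univ.erase (0 : ZMod p) ×ˢ (univ : Finset (ZMod p))).Nonempty) hmain
  simp only at hle
  obtain ⟨T, hT1, hT2⟩ := exists_finset_rounding hp (fun n => g n * (c * ind W (r * n + s)))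
    (fun n => mul_nonneg (g0 n) (mul_nonneg hc0.le (ind_nonneg _ _)))
    (fun n => by
      have h1 := mul_le_mul_of_nonneg_left (ind_le_one W (r * n + s)) hc0.le
      calc _ ≤ (1 - x) * (c * 1) := by
            gcongr
            · exact mul_nonneg hc0.le (ind_nonneg _ _)
            · exact g1 n
        _ = 1 := by linear_combination hcx)
  have hsum : ∑ n, g n * (c * ind W (r * n + s)) = ∑ n, g n + D r s := by
    rw [hD, ← Finset.sum_add_distrib]
    exact Finset.sum_congr rfl fun n _ => by ring
  have hgp : ∑ n, g n ≤ p := by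
    refine (Finset.sum_le_sum fun n _ => gle1 n).trans ?_
    simp [ZMod.card]
  obtain ⟨T', hT'1, hT'2⟩ := exists_finset_card_ge (T := T) hgp (abs_nonneg (D r s))
    (by rw [hsum] at hT1; linarith [neg_abs_le (D r s)])
  refine ⟨T', hT'1, ?_⟩
  have hDle := three_mul_abs_le hp0 (D r s)
  change apSumNT (ind T) ≤ X r s + 3 * p at hT2
  linarith

end

/-! ### Averaging along progressions and Fourier analysis -/

/-- The average of `f` over the progression `x, x + r, …, x + (k - 1) r`. -/
noncomputable def apAverage {p : ℕ} (f : ZMod p → ℝ) (r : ZMod p) (k : ℕ) (x : ZMod p) : ℝ :=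
  (∑ j ∈ Finset.range k, f (x + j * r)) / k

lemma apAverage_nonneg {p : ℕ} {f : ZMod p → ℝ} (f0 : ∀ x, 0 ≤ f x) (r : ZMod p) (k : ℕ) (x : ZMod p) :
    0 ≤ apAverage f r k x :=
  div_nonneg (Finset.sum_nonneg fun _ _ => f0 _) (Nat.cast_nonneg k)

section

variable {p : ℕ} [NeZero p]

/-- The discrete Fourier transform of a real-valued function on `ZMod p`. -/
noncomputable def fourierSum (f : ZMod p → ℝ) (a : ZMod p) : ℂ :=
  ∑ x, (f x : ℂ) * ZMod.stdAddChar (x * a)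

lemma sum_stdAddChar_mul (b : ZMod p) :
    ∑ a : ZMod p, (ZMod.stdAddChar (a * b) : ℂ) = if b = 0 then (p : ℂ) else 0 := by
  simpa [ZMod.card] using AddChar.sum_mulShift b (ZMod.isPrimitive_stdAddChar p)

lemma norm_fourierSum_le {f : ZMod p → ℝ} (f0 : ∀ x, 0 ≤ f x) (f1 : ∀ x, f x ≤ 1) (a : ZMod p) :
    ‖fourierSum f a‖ ≤ p := by
  refine (norm_sum_le _ _).trans ?_
  calc _ ≤ ∑ _x : ZMod p, (1 : ℝ) := by
        refine Finset.sum_le_sum fun x _ => ?_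
        rw [norm_mul, AddChar.norm_apply, mul_one, Complex.norm_real, Real.norm_of_nonneg (f0 x)]
        exact f1 x
    _ = p := by simp [ZMod.card]

lemma sum_norm_fourierSum_sq (f : ZMod p → ℝ) :
    ∑ a, ‖fourierSum f a‖ ^ 2 = p * ∑ x, f x ^ 2 := by
  have key : ∑ a, (fourierSum f a * (starRingEnd ℂ) (fourierSum f a)) = p * ∑ x, (f x : ℂ) ^ 2 := by
    have h : ∀ a, fourierSum f a * (starRingEnd ℂ) (fourierSum f a) =
        ∑ x, ∑ y, (f x : ℂ) * f y * ZMod.stdAddChar (a * (x - y)) := fun a => by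
      unfold fourierSum
      rw [map_sum, Finset.sum_mul_sum]
      refine Finset.sum_congr rfl fun x _ => Finset.sum_congr rfl fun y _ => ?_
      rw [map_mul (starRingEnd ℂ), Complex.conj_ofReal, ← AddChar.map_neg_eq_conj,
        show a * (x - y) = x * a + -(y * a) by ring, AddChar.map_add_eq_mul]
      ring
    simp only [h]
    rw [Finset.sum_comm, Finset.mul_sum]
    refine Finset.sum_congr rfl fun x _ => ?_
    rw [Finset.sum_comm]
    simp only [← Finset.mul_sum, sum_stdAddChar_mul, sub_eq_zero]
    simp
    ring
  simp only [Complex.mul_conj'] at key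
  exact_mod_cast key

/-- Progressions are the solutions of `x + z = 2 y`, which orthogonality of characters detects. -/
lemma sum_fourierSum_triple (f : ZMod p → ℝ) :
    ∑ a, fourierSum f a ^ 2 * fourierSum f (-2 * a) = p * (apSum f : ℂ) := by
  have h : ∀ a, fourierSum f a ^ 2 * fourierSum f (-2 * a) =
      ∑ x, ∑ y, ∑ z, (f x : ℂ) * f y * f z * ZMod.stdAddChar (a * (x + z - 2 * y)) := fun a => by
    rw [sq, mul_right_comm]
    unfold fourierSum
    rw [Finset.sum_mul_sum, Finset.sum_mul]
    refine Finset.sum_congr rfl fun x _ => ?_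
    rw [Finset.sum_mul_sum]
    refine Finset.sum_congr rfl fun y _ => Finset.sum_congr rfl fun z _ => ?_
    rw [show a * (x + z - 2 * y) = x * a + y * (-2 * a) + z * a by ring,
      AddChar.map_add_eq_mul, AddChar.map_add_eq_mul]
    ring
  simp only [h, apSum]
  rw [Finset.sum_comm, Complex.ofReal_sum, Finset.mul_sum]
  refine Finset.sum_congr rfl fun x _ => ?_
  rw [Finset.sum_comm, Complex.ofReal_sum, Finset.mul_sum]
  rw [← Equiv.sum_comp (Equiv.addLeft x)]
  refine Finset.sum_congr rfl fun m _ => ?_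
  rw [Finset.sum_comm]
  simp only [← Finset.mul_sum, sum_stdAddChar_mul, Equiv.coe_addLeft]
  have : ∀ z, (x + z - 2 * (x + m) = 0) ↔ z = x + 2 * m := fun z =>
    ⟨fun h => by linear_combination h, fun h => by rw [h]; ring⟩
  simp only [this, mul_ite, mul_zero, Finset.sum_ite_eq', Finset.mem_univ, if_true]
  push_cast
  ring

/-- The Fourier multiplier of `apAverage`. -/
noncomputable def apMultiplier (r : ZMod p) (k : ℕ) (a : ZMod p) : ℂ :=
  (∑ j ∈ Finset.range k, ZMod.stdAddChar (-((j : ZMod p) * (r * a)))) / k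

lemma fourierSum_apAverage (f : ZMod p → ℝ) (r : ZMod p) (k : ℕ) (a : ZMod p) :
    fourierSum (apAverage f r k) a = apMultiplier r k a * fourierSum f a := by
  unfold fourierSum apAverage apMultiplier
  simp only [Complex.ofReal_div, Complex.ofReal_sum, Complex.ofReal_natCast, div_mul_eq_mul_div,
    ← Finset.sum_div]
  congr 1
  simp only [Finset.sum_mul]
  rw [Finset.sum_comm]
  refine Finset.sum_congr rfl fun j _ => ?_
  rw [Finset.mul_sum, ← Equiv.sum_comp (Equiv.addRight ((j : ZMod p) * r))
    fun x => (ZMod.stdAddChar (-((j : ZMod p) * (r * a))) : ℂ) * (f x * ZMod.stdAddChar (x * a))]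
  refine Finset.sum_congr rfl fun x _ => ?_
  simp only [Equiv.coe_addRight]
  rw [show x * a = -(j * (r * a)) + (x + j * r) * a by ring, AddChar.map_add_eq_mul]
  ring

lemma sum_apAverage (f : ZMod p → ℝ) (r : ZMod p) {k : ℕ} (hk : 0 < k) :
    ∑ x, apAverage f r k x = ∑ x, f x := by
  have hk' : (k : ℝ) ≠ 0 := by positivity
  unfold apAverage
  rw [← Finset.sum_div, Finset.sum_comm, div_eq_iff hk']
  have : ∀ j : ℕ, ∑ x, f (x + j * r) = ∑ x, f x := fun j =>
    Equiv.sum_comp (Equiv.addRight ((j : ZMod p) * r)) f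
  simp only [this, Finset.sum_const, Finset.card_range, nsmul_eq_mul]
  ring

lemma norm_apMultiplier_le (r : ZMod p) {k : ℕ} (hk : 0 < k) (a : ZMod p) :
    ‖apMultiplier r k a‖ ≤ 1 := by
  unfold apMultiplier
  rw [norm_div, Complex.norm_natCast, div_le_one (by positivity)]
  refine (norm_sum_le _ _).trans ?_
  simp [AddChar.norm_apply]

lemma norm_stdAddChar_add_sub_one_le (b c : ZMod p) :
    ‖(ZMod.stdAddChar (b + c) : ℂ) - 1‖ ≤
      ‖(ZMod.stdAddChar b : ℂ) - 1‖ + ‖(ZMod.stdAddChar c : ℂ) - 1‖ := by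
  rw [AddChar.map_add_eq_mul]
  calc _ = ‖(ZMod.stdAddChar b : ℂ) * (ZMod.stdAddChar c - 1) + (ZMod.stdAddChar b - 1)‖ := by
        congr 1; ring
    _ ≤ _ := (norm_add_le _ _).trans (by rw [norm_mul, AddChar.norm_apply]; linarith)

lemma norm_stdAddChar_neg_sub_one (b : ZMod p) :
    ‖(ZMod.stdAddChar (-b) : ℂ) - 1‖ = ‖(ZMod.stdAddChar b : ℂ) - 1‖ := by
  rw [AddChar.map_neg_eq_conj, ← Complex.norm_conj]
  simp

lemma norm_stdAddChar_natCast_mul_sub_one_le (j : ℕ) (b : ZMod p) :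
    ‖(ZMod.stdAddChar ((j : ZMod p) * b) : ℂ) - 1‖ ≤ j * ‖(ZMod.stdAddChar b : ℂ) - 1‖ := by
  induction j with
  | zero => simp
  | succ j ih =>
    rw [Nat.cast_succ, add_mul, one_mul]
    refine (norm_stdAddChar_add_sub_one_le _ _).trans ?_
    push_cast
    linarith

lemma norm_one_sub_apMultiplier_le (r : ZMod p) {k : ℕ} (hk : 0 < k) (a : ZMod p) :
    ‖1 - apMultiplier r k a‖ ≤ k * ‖(ZMod.stdAddChar (r * a) : ℂ) - 1‖ := by
  have hk' : (k : ℂ) ≠ 0 := by exact_mod_cast hk.ne'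
  have e : 1 - apMultiplier r k a =
      (∑ j ∈ Finset.range k, (1 - ZMod.stdAddChar (-((j : ZMod p) * (r * a))))) / k := by
    unfold apMultiplier
    rw [Finset.sum_sub_distrib, sub_div]
    simp [hk']
  rw [e, norm_div, Complex.norm_natCast, div_le_iff₀ (by positivity)]
  refine (norm_sum_le _ _).trans ?_
  calc _ ≤ ∑ _j ∈ Finset.range k, k * ‖(ZMod.stdAddChar (r * a) : ℂ) - 1‖ := by
        refine Finset.sum_le_sum fun j hj => ?_
        rw [norm_sub_rev, norm_stdAddChar_neg_sub_one]
        refine (norm_stdAddChar_natCast_mul_sub_one_le _ _).trans ?_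
        gcongr
        exact (Finset.mem_range.1 hj).le
    _ = _ := by simp; ring

/-- Averaging over a progression whose step nearly annihilates the large spectrum hardly changes
the number of three-term progressions. -/
lemma abs_apSum_sub_apAverage_le {f : ZMod p → ℝ} (f0 : ∀ x, 0 ≤ f x) (f1 : ∀ x, f x ≤ 1)
    {r : ZMod p} {k : ℕ} (hk : 0 < k) {τ η : ℝ} (hτ : 0 ≤ τ) (hη : 0 ≤ η)
    (hr : ∀ a : ZMod p, τ * p < ‖fourierSum f (-2 * a)‖ →
      ‖(ZMod.stdAddChar (r * a) : ℂ) - 1‖ ≤ η) :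
    |apSum f - apSum (apAverage f r k)| ≤ (2 * τ + 4 * k * η) * p ^ 2 := by
  have hp0 : (0 : ℝ) < p := by exact_mod_cast NeZero.pos p
  set F := fourierSum f
  set M := apMultiplier r k
  have e : ((p * (apSum f - apSum (apAverage f r k)) : ℝ) : ℂ) =
      ∑ a, F a ^ 2 * F (-2 * a) * (1 - M a ^ 2 * M (-2 * a)) := by
    push_cast
    rw [mul_sub, ← sum_fourierSum_triple, ← sum_fourierSum_triple, ← Finset.sum_sub_distrib]
    refine Finset.sum_congr rfl fun a _ => ?_
    simp only [fourierSum_apAverage]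
    ring
  have hM : ∀ a, ‖M a‖ ≤ 1 := norm_apMultiplier_le r hk
  have hterm : ∀ a, ‖F a ^ 2 * F (-2 * a) * (1 - M a ^ 2 * M (-2 * a))‖ ≤
      (2 * τ + 4 * k * η) * p * ‖F a‖ ^ 2 := by
    intro a
    rw [norm_mul, norm_mul, norm_pow]
    -- Either the factor at `-2 * a` is small, or `r` nearly annihilates `a` and all three
    -- multipliers are close to `1`. The remaining `‖F a‖ ^ 2` is summed by Parseval.
    rcases le_or_gt ‖F (-2 * a)‖ (τ * p) with h | h
    · have h2 : ‖1 - M a ^ 2 * M (-2 * a)‖ ≤ 2 := by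
        refine (norm_sub_le _ _).trans ?_
        rw [norm_one, norm_mul, norm_pow]
        have := mul_le_one₀ (pow_le_one₀ (n := 2) (norm_nonneg _) (hM a)) (norm_nonneg _)
          (hM (-2 * a))
        linarith
      calc _ ≤ ‖F a‖ ^ 2 * (τ * p) * 2 := by gcongr
        _ ≤ ‖F a‖ ^ 2 * (τ * p) * 2 + 4 * k * η * p * ‖F a‖ ^ 2 :=
          le_add_of_nonneg_right (by positivity)
        _ = _ := by ring
    · have h1 := hr a h
      have h3 : ‖(ZMod.stdAddChar (r * (-2 * a)) : ℂ) - 1‖ ≤ 2 * η := by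
        rw [show r * (-2 * a) = -(((2 : ℕ) : ZMod p) * (r * a)) by push_cast; ring,
          norm_stdAddChar_neg_sub_one]
        refine (norm_stdAddChar_natCast_mul_sub_one_le _ _).trans ?_
        push_cast
        linarith
      have hk0 : (0 : ℝ) ≤ k := by positivity
      have m1 : ‖1 - M a‖ ≤ k * η :=
        (norm_one_sub_apMultiplier_le r hk a).trans (mul_le_mul_of_nonneg_left h1 hk0)
      have m2 : ‖1 - M (-2 * a)‖ ≤ k * (2 * η) :=
        (norm_one_sub_apMultiplier_le r hk _).trans (mul_le_mul_of_nonneg_left h3 hk0)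
      have m3 : ‖1 - M a ^ 2 * M (-2 * a)‖ ≤ 4 * k * η := by
        rw [show 1 - M a ^ 2 * M (-2 * a) =
          (1 - M a) + M a * (1 - M a) + M a ^ 2 * (1 - M (-2 * a)) by ring]
        refine (norm_add₃_le).trans ?_
        rw [norm_mul, norm_mul, norm_pow]
        have n1 := mul_le_of_le_one_left (norm_nonneg (1 - M a)) (hM a)
        have n2 := mul_le_of_le_one_left (norm_nonneg (1 - M (-2 * a)))
          (pow_le_one₀ (n := 2) (norm_nonneg _) (hM a))
        linarith
      calc _ ≤ ‖F a‖ ^ 2 * p * (4 * k * η) := by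
            gcongr
            exact norm_fourierSum_le f0 f1 _
        _ ≤ ‖F a‖ ^ 2 * p * (4 * k * η) + 2 * τ * p * ‖F a‖ ^ 2 :=
          le_add_of_nonneg_right (by positivity)
        _ = _ := by ring
  have hsum : ∑ a, ‖F a‖ ^ 2 ≤ (p : ℝ) * p := by
    rw [sum_norm_fourierSum_sq]
    gcongr
    calc _ ≤ ∑ _x : ZMod p, (1 : ℝ) := Finset.sum_le_sum fun x _ => pow_le_one₀ (f0 x) (f1 x)
      _ = p := by simp [ZMod.card]
  have hfin : (p : ℝ) * |apSum f - apSum (apAverage f r k)| ≤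
      p * ((2 * τ + 4 * k * η) * p ^ 2) := by
    calc _ = ‖((p * (apSum f - apSum (apAverage f r k)) : ℝ) : ℂ)‖ := by
          rw [Complex.norm_real, Real.norm_eq_abs, abs_mul, abs_of_pos hp0]
      _ ≤ ∑ a, (2 * τ + 4 * k * η) * p * ‖F a‖ ^ 2 := by
          rw [e]
          exact (norm_sum_le _ _).trans (Finset.sum_le_sum fun a _ => hterm a)
      _ ≤ (2 * τ + 4 * k * η) * p * (p * p) := by
          rw [← Finset.mul_sum]
          gcongr
      _ = _ := by ring
  exact le_of_mul_le_mul_left hfin hp0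

/-- Simultaneous Diophantine approximation in `ZMod p`. -/
lemma exists_ne_zero_norm_stdAddChar_le (D : Finset (ZMod p)) {Q : ℕ} (hQ : 0 < Q)
    (hlt : Q ^ D.card < p) :
    ∃ r : ZMod p, r ≠ 0 ∧ ∀ a ∈ D, ‖(ZMod.stdAddChar (r * a) : ℂ) - 1‖ ≤ 2 * Real.pi / Q := by
  have hp0 : 0 < p := NeZero.pos p
  have hpR : (0 : ℝ) < p := by exact_mod_cast hp0
  have hQR : (0 : ℝ) < Q := by exact_mod_cast hQ
  -- Dirichlet's pigeonhole: two multipliers `r₁`, `r₂` share a box of side `p / Q` in every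
  -- coordinate, and their difference is the step.
  let box : ZMod p → D → Fin Q := fun r a =>
    ⟨Q * (r * a.1).val / p, by
      rw [Nat.div_lt_iff_lt_mul hp0]
      exact Nat.mul_lt_mul_of_pos_left (ZMod.val_lt _) hQ⟩
  have hcard : Fintype.card (D → Fin Q) < Fintype.card (ZMod p) := by
    simpa [ZMod.card] using hlt
  obtain ⟨r₁, r₂, hne, heq⟩ := Fintype.exists_ne_map_eq_of_card_lt box hcard
  refine ⟨r₁ - r₂, sub_ne_zero.2 hne, fun a ha => ?_⟩
  have hfl : Q * (r₁ * a).val / p = Q * (r₂ * a).val / p :=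
    congrArg Fin.val (congrFun heq ⟨a, ha⟩)
  set v₁ := (r₁ * a).val with hv₁
  set v₂ := (r₂ * a).val with hv₂
  have hcast : (r₁ - r₂) * a = (((v₁ : ℤ) - v₂ : ℤ) : ZMod p) := by
    push_cast
    rw [hv₁, hv₂, ZMod.natCast_zmod_val, ZMod.natCast_zmod_val]
    ring
  rw [hcast, ZMod.stdAddChar_coe]
  have hexp : (2 * Real.pi * Complex.I * (((v₁ : ℤ) - v₂ : ℤ) : ℂ) / p : ℂ) =
      Complex.I * ((2 * Real.pi * ((v₁ : ℝ) - v₂) / p : ℝ) : ℂ) := by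
    push_cast; ring
  rw [hexp]
  refine (Real.norm_exp_I_mul_ofReal_sub_one_le).trans ?_
  have hd : |((v₁ : ℝ) - v₂)| * Q ≤ p := by
    have h1 := Nat.div_add_mod (Q * v₁) p
    have h2 := Nat.div_add_mod (Q * v₂) p
    rw [hfl] at h1
    have l1 := Nat.mod_lt (Q * v₁) hp0
    have l2 := Nat.mod_lt (Q * v₂) hp0
    have i1 : Q * v₁ ≤ Q * v₂ + p := by omega
    have i2 : Q * v₂ ≤ Q * v₁ + p := by omega
    have i1' : (Q : ℝ) * v₁ ≤ Q * v₂ + p := by exact_mod_cast i1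
    have i2' : (Q : ℝ) * v₂ ≤ Q * v₁ + p := by exact_mod_cast i2
    rw [← abs_of_pos hQR, ← abs_mul, abs_le]
    constructor <;> linarith
  rw [Real.norm_eq_abs, abs_div, abs_mul, abs_of_pos Real.two_pi_pos, abs_of_pos hpR,
    div_le_div_iff₀ hpR hQR]
  calc _ = 2 * Real.pi * (|((v₁ : ℝ) - v₂)| * Q) := by ring
    _ ≤ _ := by have := Real.pi_pos; gcongr

end

section

variable {p : ℕ} [Fact p.Prime]

/-- The size of the large spectrum, dilated by `-2`. -/
lemma card_large_spectrum_le (hp : 2 < p) {f : ZMod p → ℝ} (f0 : ∀ x, 0 ≤ f x)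
    (f1 : ∀ x, f x ≤ 1) {τ : ℝ} (hτ : 0 < τ) :
    ((univ.filter fun a : ZMod p => τ * p < ‖fourierSum f (-2 * a)‖).card : ℝ) ≤ 1 / τ ^ 2 := by
  have hp0 : (0 : ℝ) < p := by exact_mod_cast (by omega : 0 < p)
  set D := univ.filter fun a : ZMod p => τ * p < ‖fourierSum f (-2 * a)‖
  have h2 : (-2 : ZMod p) ≠ 0 := neg_ne_zero.2 (two_ne_zero_zmod hp)
  have h : (D.card : ℝ) * (τ * p) ^ 2 ≤ p * p := by
    calc (D.card : ℝ) * (τ * p) ^ 2 = ∑ _a ∈ D, (τ * p) ^ 2 := by simp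
      _ ≤ ∑ a ∈ D, ‖fourierSum f (-2 * a)‖ ^ 2 := by
          refine Finset.sum_le_sum fun a ha => ?_
          have := (Finset.mem_filter.1 ha).2
          gcongr
      _ ≤ ∑ a, ‖fourierSum f (-2 * a)‖ ^ 2 :=
          Finset.sum_le_sum_of_subset_of_nonneg (Finset.subset_univ _) fun _ _ _ => by positivity
      _ = ∑ a, ‖fourierSum f a‖ ^ 2 :=
          Equiv.sum_comp (Equiv.mulLeft₀ (-2 : ZMod p) h2) fun a => ‖fourierSum f a‖ ^ 2
      _ ≤ p * p := by
          rw [sum_norm_fourierSum_sq]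
          gcongr
          calc _ ≤ ∑ _x : ZMod p, (1 : ℝ) :=
                Finset.sum_le_sum fun x _ => pow_le_one₀ (f0 x) (f1 x)
            _ = p := by simp [ZMod.card]
  rw [le_div_iff₀ (by positivity)]
  have : (D.card : ℝ) * τ ^ 2 * (p * p) ≤ 1 * (p * p) := by linarith
  exact le_of_mul_le_mul_right this (by positivity)

/-- Some nontrivial step `r` makes the averages over progressions with step `r` nearly preserve
the number of three-term progressions. -/
theorem exists_step_abs_apSum_sub_le (hp : 2 < p) {f : ZMod p → ℝ} (f0 : ∀ x, 0 ≤ f x)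
    (f1 : ∀ x, f x ≤ 1) {τ : ℝ} (hτ : 0 < τ) {k Q : ℕ} (hk : 0 < k) (hQ : 0 < Q)
    (hlt : 1 / τ ^ 2 * Real.log Q < Real.log p) :
    ∃ r : ZMod p, r ≠ 0 ∧
      |apSum f - apSum (apAverage f r k)| ≤ (2 * τ + 8 * Real.pi * k / Q) * p ^ 2 := by
  have hp0 : (0 : ℝ) < p := by exact_mod_cast (by omega : 0 < p)
  have hQR : (1 : ℝ) ≤ Q := by exact_mod_cast hQ
  set D := univ.filter fun a : ZMod p => τ * p < ‖fourierSum f (-2 * a)‖ with hD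
  have hDc : (D.card : ℝ) ≤ 1 / τ ^ 2 := card_large_spectrum_le hp f0 f1 hτ
  -- There are `Q ^ D.card` boxes, so the pigeonhole permits a spectrum of size only about `log p /
  -- log Q`.
  have hpow : Q ^ D.card < p := by
    have : (Q : ℝ) ^ D.card < p := by
      rw [← Real.log_lt_log_iff (by positivity) hp0, Real.log_pow]
      exact (mul_le_mul_of_nonneg_right hDc (Real.log_nonneg hQR)).trans_lt hlt
    exact_mod_cast this
  obtain ⟨r, hr0, hr⟩ := exists_ne_zero_norm_stdAddChar_le D hQ hpow
  refine ⟨r, hr0, ?_⟩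
  have := abs_apSum_sub_apAverage_le f0 f1 (r := r) hk hτ.le (η := 2 * Real.pi / Q)
    (by have := Real.pi_pos; positivity)
    fun a ha => hr a (by rw [hD]; exact Finset.mem_filter.2 ⟨Finset.mem_univ _, ha⟩)
  refine this.trans (le_of_eq ?_)
  ring

end

/-! ### Supersaturation -/

section

variable {p : ℕ} [Fact p.Prime]

lemma natCast_sub_ne_zero {M i b : ℕ} (hM : M ≤ p) (hi : i < M) (hb : b < M) (hib : i ≠ b) :
    ((b : ZMod p) - i) ≠ 0 := by
  rw [sub_ne_zero]
  intro h
  exact hib (natCast_injOn_range hM (by simpa using hi) (by simpa using hb) h.symm)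

/-- Supersaturation: if sets of density `d / 2` in `range M` contain three-term progressions, then
sets of density `d` in `ZMod p` contain many. -/
lemma le_apSumNT_of_roth {d : ℝ} (hd : 0 < d) {M : ℕ} (hM0 : 0 < M) (hMp : M ≤ p)
    (hroth : ∀ A ⊆ Finset.range M, d / 2 * M ≤ A.card → ¬ ThreeAPFree (A : Set ℕ))
    {S : Finset (ZMod p)} (hS : d * p ≤ S.card) :
    d / 4 / (M : ℝ) ^ 2 * (p : ℝ) ^ 2 ≤ apSumNT (ind S) := by
  have hp2 : (2 : ℝ) ≤ p := by exact_mod_cast (Fact.out : p.Prime).two_le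
  have hMR : (0 : ℝ) < M := by exact_mod_cast hM0
  have hcard : ((univ.erase (0 : ZMod p)).card : ℝ) = p - 1 := by
    rw [Finset.card_erase_of_mem (Finset.mem_univ _), Finset.card_univ, ZMod.card,
      Nat.cast_sub (Fact.out : p.Prime).one_le, Nat.cast_one]
  set φ : ZMod p → ZMod p → ℝ := fun x y => ind S x * ind S (x + y) * ind S (x + 2 * y) with hφ
  have hφ0 : ∀ x y, 0 ≤ φ x y := fun x y =>
    mul_nonneg (mul_nonneg (ind_nonneg _ _) (ind_nonneg _ _)) (ind_nonneg _ _)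
  -- In each affine copy of `range M`, either `S` has density below `d / 2`, or there is a
  -- nontrivial progression and `M` times their number exceeds any possible intersection. Averaging
  -- over copies gives the bound.
  have hpt : ∀ r a : ZMod p, ∑ j ∈ Finset.range M, ind S (r * j + a) ≤
      d / 2 * M + M * ∑ i ∈ Finset.range M, ∑ b ∈ (Finset.range M).erase i,
        φ (r * i + a) (r * (b - i)) := by
    intro r a
    have hN0 : 0 ≤ ∑ i ∈ Finset.range M, ∑ b ∈ (Finset.range M).erase i,
        φ (r * i + a) (r * (b - i)) :=
      Finset.sum_nonneg fun _ _ => Finset.sum_nonneg fun _ _ => hφ0 _ _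
    set A := (Finset.range M).filter fun j : ℕ => r * j + a ∈ S with hA
    have hAsum : ∑ j ∈ Finset.range M, ind S (r * j + a) = A.card := by
      simp [ind, hA]
    rw [hAsum]
    rcases lt_or_ge (A.card : ℝ) (d / 2 * M) with h | h
    · nlinarith
    · have hnot := hroth A (Finset.filter_subset _ _) h
      unfold ThreeAPFree at hnot
      push Not at hnot
      obtain ⟨i, hi, b, hb, c, hc, hibc, hib⟩ := hnot
      simp only [hA, Finset.coe_filter, Finset.mem_range, Set.mem_ofPred_eq] at hi hb hc
      have hone : φ (r * i + a) (r * (b - i)) = 1 := by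
        have e1 : r * i + a + r * (b - i) = r * b + a := by ring
        have e2 : r * i + a + 2 * (r * (b - i)) = r * c + a := by
          have : (i : ZMod p) + c = b + b := by exact_mod_cast congrArg (Nat.cast (R := ZMod p)) hibc
          linear_combination (-r) * this
        simp only [hφ, e1, e2, ind, hi.2, hb.2, hc.2, if_true, mul_one]
      have hN1 : 1 ≤ ∑ i ∈ Finset.range M, ∑ b ∈ (Finset.range M).erase i,
          φ (r * i + a) (r * (b - i)) := by
        calc (1 : ℝ) = φ (r * i + a) (r * (b - i)) := hone.symm
          _ ≤ ∑ b ∈ (Finset.range M).erase i, φ (r * i + a) (r * (b - i)) :=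
            Finset.single_le_sum (f := fun b : ℕ => φ (r * i + a) (r * (b - i)))
              (fun _ _ => hφ0 _ _)
              (Finset.mem_erase.2 ⟨Ne.symm hib, Finset.mem_range.2 hb.1⟩)
          _ ≤ _ := Finset.single_le_sum
              (f := fun i : ℕ => ∑ b ∈ (Finset.range M).erase i, φ (r * i + a) (r * (b - i)))
              (fun _ _ => Finset.sum_nonneg fun _ _ => hφ0 _ _) (Finset.mem_range.2 hi.1)
      have hAM : (A.card : ℝ) ≤ M := by
        have := Finset.card_le_card (Finset.filter_subset (fun j : ℕ => r * j + a ∈ S)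
          (Finset.range M))
        rw [Finset.card_range] at this
        exact_mod_cast this
      have := mul_le_mul_of_nonneg_left hN1 hMR.le
      have : 0 ≤ d / 2 * M := by positivity
      linarith
  have hNT : apSumNT (ind S) = ∑ y ∈ univ.erase (0 : ZMod p), ∑ x, φ x y := by
    unfold apSumNT
    rw [Finset.sum_comm]
  have hsum := Finset.sum_le_sum fun (r : ZMod p) (_ : r ∈ univ.erase (0 : ZMod p)) =>
    Finset.sum_le_sum fun (a : ZMod p) (_ : a ∈ univ) => hpt r a
  have hL : ∑ r ∈ univ.erase (0 : ZMod p), ∑ a, ∑ j ∈ Finset.range M, ind S (r * j + a) =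
      (p - 1) * (M * S.card) := by
    have : ∀ r : ZMod p, ∑ a, ∑ j ∈ Finset.range M, ind S (r * j + a) = M * S.card := fun r => by
      rw [Finset.sum_comm]
      have : ∀ j : ℕ, ∑ a, ind S (r * j + a) = S.card := fun j => by
        rw [← sum_ind]
        exact Equiv.sum_comp (Equiv.addLeft (r * j)) (ind S)
      simp [this]
    rw [Finset.sum_congr rfl fun r _ => this r, Finset.sum_const, nsmul_eq_mul, hcard]
  have hR : ∑ r ∈ univ.erase (0 : ZMod p), ∑ a, ∑ i ∈ Finset.range M,
      ∑ b ∈ (Finset.range M).erase i, φ (r * i + a) (r * (b - i)) ≤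
      (M : ℝ) ^ 2 * apSumNT (ind S) := by
    have e : ∑ r ∈ univ.erase (0 : ZMod p), ∑ a, ∑ i ∈ Finset.range M,
        ∑ b ∈ (Finset.range M).erase i, φ (r * i + a) (r * (b - i)) =
        ∑ i ∈ Finset.range M, ∑ b ∈ (Finset.range M).erase i,
          ∑ r ∈ univ.erase (0 : ZMod p), ∑ a, φ (r * i + a) (r * (b - i)) := by
      rw [Finset.sum_congr rfl fun r _ => Finset.sum_comm, Finset.sum_comm]
      refine Finset.sum_congr rfl fun i _ => ?_
      rw [Finset.sum_congr rfl fun r _ => Finset.sum_comm, Finset.sum_comm]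
    rw [e]
    calc _ = ∑ i ∈ Finset.range M, ∑ _b ∈ (Finset.range M).erase i, apSumNT (ind S) := by
          refine Finset.sum_congr rfl fun i hi => Finset.sum_congr rfl fun b hb => ?_
          rw [hNT]
          exact sum_affine _ (natCast_sub_ne_zero hMp (Finset.mem_range.1 hi)
            (Finset.mem_range.1 (Finset.mem_of_mem_erase hb)) (Finset.ne_of_mem_erase hb).symm) φ
      _ ≤ ∑ _i ∈ Finset.range M, ∑ _b ∈ Finset.range M, apSumNT (ind S) :=
          Finset.sum_le_sum fun i _ => Finset.sum_le_sum_of_subset_of_nonneg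
            (Finset.erase_subset _ _) fun _ _ _ => apSumNT_nonneg (ind_nonneg S)
      _ = _ := by simp; ring
  rw [hL] at hsum
  simp only [Finset.sum_add_distrib, ← Finset.mul_sum] at hsum
  rw [Finset.sum_const, Finset.sum_const, nsmul_eq_mul, nsmul_eq_mul, hcard, Finset.card_univ,
    ZMod.card] at hsum
  have h1 := mul_le_mul_of_nonneg_left hR hMR.le
  have h2 := mul_le_mul_of_nonneg_left hS (mul_nonneg (by linarith : (0 : ℝ) ≤ p - 1) hMR.le)
  have h3 : M * (d / 2 * (p * (p - 1))) ≤ M * ((M : ℝ) ^ 2 * apSumNT (ind S)) := by nlinarith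
  have h4 := le_of_mul_le_mul_left h3 hMR
  -- Uses `p - 1 ≥ p / 2`, whence `d / 4`.
  have h5 : d / 4 * (p : ℝ) ^ 2 ≤ (M : ℝ) ^ 2 * apSumNT (ind S) := by
    refine le_trans ?_ h4
    nlinarith [mul_nonneg hd.le (mul_nonneg (by linarith : (0 : ℝ) ≤ p) (sub_nonneg.2 hp2))]
  rw [div_mul_eq_mul_div, div_le_iff₀ (by positivity)]
  linarith

end

/-- The theorem of Varnavides. -/
theorem exists_forall_le_apSumNT {d : ℝ} (hd : 0 < d) :
    ∃ c : ℝ, 0 < c ∧ ∃ p₀ : ℕ, ∀ (p : ℕ) [Fact p.Prime], p₀ ≤ p →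
      ∀ S : Finset (ZMod p), d * p ≤ S.card → c * (p : ℝ) ^ 2 ≤ apSumNT (ind S) := by
  -- The threshold of Roth's theorem at density `d / 2`; the `+ 1` makes `M` positive.
  set M := cornersTheoremBound (d / 2 / 3) + 1
  refine ⟨d / 4 / (M : ℝ) ^ 2, by positivity, M, fun p _ hp S hS => ?_⟩
  exact le_apSumNT_of_roth hd (Nat.succ_pos _) hp
    (fun A hA hc => roth_3ap_theorem_nat (d / 2) (by positivity) (Nat.le_succ _) A hA hc) hS

/-! ### Critical sets nearly fill a progression -/

section

variable {p : ℕ} [Fact p.Prime]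

/-- A critical set is almost full on some translate of a long progression. -/
theorem IsCriticalSet.exists_apAverage_gt (hp : 2 < p) {d c τ : ℝ} {S : Finset (ZMod p)}
    (hS : IsCriticalSet d S) (hc : c * (p : ℝ) ^ 2 ≤ apSumNT (ind S)) (hτ : 0 < τ)
    {k Q q : ℕ} (hk : 0 < k) (hQ : 0 < Q) (hq : 54 * q ≤ p)
    (hlog : 1 / τ ^ 2 * Real.log Q < Real.log p)
    (herr : 2 * τ + 8 * Real.pi * k / Q + 12 / √p < c * (3 * q / p) ^ 2 / 18) :
    ∃ r a : ZMod p, r ≠ 0 ∧ 1 - 3 * q / p < apAverage (ind S) r k a := by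
  obtain ⟨r, hr0, hr⟩ := exists_step_abs_apSum_sub_le hp (ind_nonneg S) (ind_le_one S) hτ hk hQ hlog
  by_contra! hcon
  have g0 := apAverage_nonneg (ind_nonneg S) r k
  obtain ⟨T, hT1, hT2⟩ := exists_finset_fewer_ap hp hq g0 (fun a => hcon r a hr0)
  rw [sum_apAverage _ _ hk, sum_ind] at hT1
  have hcrit : apSum (ind S) ≤ apSum (ind T) := by
    rw [← threeAPCount_eq_apSum, ← threeAPCount_eq_apSum]
    exact_mod_cast hS.2 T (hS.1.trans hT1)
  have hT3 := apSum_le_apSumNT_add (ind_nonneg T) (ind_le_one T)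
  have hG := apSumNT_le_apSum g0
  have hF := apSumNT_le_apSum (ind_nonneg S)
  have hp1 : (1 : ℝ) ≤ p := by exact_mod_cast (by omega : 1 ≤ p)
  have hp0 : (0 : ℝ) < p := by linarith
  have hs1 : 1 ≤ √(p : ℝ) := Real.one_le_sqrt.2 hp1
  have hx0 : (0 : ℝ) ≤ 3 * q / p := by positivity
  have hx1 : (3 * q / p : ℝ) ≤ 1 := by
    rw [div_le_one hp0]
    exact_mod_cast (by omega : 3 * q ≤ p)
  set x : ℝ := 3 * q / p
  set E : ℝ := 2 * τ + 8 * Real.pi * k / Q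
  have hE0 : 0 ≤ E := by
    have := Real.pi_pos
    positivity
  have hx2 : 0 ≤ 1 - x ^ 2 / 18 := by nlinarith
  have hd := (abs_le.1 hr).1
  have h1 : apSumNT (apAverage (ind S) r k) * (1 - x ^ 2 / 18) ≤
      (apSum (ind S) + E * p ^ 2) * (1 - x ^ 2 / 18) :=
    mul_le_mul_of_nonneg_right (by linarith) hx2
  have h2 : E * (p : ℝ) ^ 2 * (1 - x ^ 2 / 18) ≤ E * (p : ℝ) ^ 2 :=
    mul_le_of_le_one_right (by positivity) (by nlinarith [sq_nonneg x])
  have h3 : c * (p : ℝ) ^ 2 * (x ^ 2 / 18) ≤ apSum (ind S) * (x ^ 2 / 18) :=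
    mul_le_mul_of_nonneg_right (hc.trans hF) (by positivity)
  have h4 : (p : ℝ) ≤ p * √p := le_mul_of_one_le_right hp0.le hs1
  -- The `12` collects `8 p + 3 p √p` from thinning and rounding and `p` from trivial progressions.
  have h5 : c * (p : ℝ) ^ 2 * (x ^ 2 / 18) ≤ E * p ^ 2 + 12 * (p * √p) := by linarith
  have h6 := mul_lt_mul_of_pos_right herr (by positivity : (0 : ℝ) < p ^ 2)
  have h7 : 12 / √(p : ℝ) * p ^ 2 = 12 * (p * √p) := by
    rw [div_mul_eq_mul_div, div_eq_iff (by positivity)]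
    linear_combination (-12 * (p : ℝ)) * Real.mul_self_sqrt hp0.le
  linarith

lemma isAPOfLength_image {k : ℕ} (hk : k ≤ p) (a : ZMod p) {r : ZMod p} (hr : r ≠ 0) :
    IsAPOfLength ((Finset.range k).image fun j : ℕ => a + (j : ZMod p) * r) k := by
  refine ⟨a, r, rfl, ?_⟩
  rw [Finset.card_image_of_injOn, Finset.card_range]
  intro i hi j hj hij
  exact natCast_injOn_range hk hi hj (mul_right_cancel₀ hr (add_left_cancel hij))

lemma card_inter_image_eq {k : ℕ} (hk0 : 0 < k) (hk : k ≤ p) (S : Finset (ZMod p)) (a : ZMod p)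
    {r : ZMod p} (hr : r ≠ 0) :
    ((S ∩ (Finset.range k).image fun j : ℕ => a + (j : ZMod p) * r).card : ℝ) =
      k * apAverage (ind S) r k a := by
  have hinj : Set.InjOn (fun j : ℕ => a + (j : ZMod p) * r) (Finset.range k) := fun i hi j hj hij =>
    natCast_injOn_range hk hi hj (mul_right_cancel₀ hr (add_left_cancel hij))
  have hk' : (k : ℝ) ≠ 0 := by positivity
  unfold apAverage
  rw [mul_div_cancel₀ _ hk', Finset.inter_comm, ← Finset.filter_mem_eq_inter,
    Finset.card_filter, Finset.sum_image hinj]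
  simp [ind]

end

/-- If few elements of `range k` fail `P`, then some block of length `m` consists of elements
satisfying `P`. -/
lemma exists_block {P : ℕ → Prop} [DecidablePred P] {k m : ℕ}
    (h : ((Finset.range k).filter fun j => ¬ P j).card < k / m) :
    ∃ b, b * m + m ≤ k ∧ ∀ i < m, P (b * m + i) := by
  by_contra! hcon
  have hb : ∀ b < k / m, b * m + m ≤ k := fun b hb => by
    calc b * m + m = (b + 1) * m := by ring
      _ ≤ k / m * m := Nat.mul_le_mul_right m hb
      _ ≤ k := Nat.div_mul_le_self k m
  have hex : ∀ b, ∃ i, b < k / m → i < m ∧ ¬ P (b * m + i) := fun b => by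
    by_cases hlt : b < k / m
    · obtain ⟨i, hi⟩ := hcon b (hb b hlt)
      exact ⟨i, fun _ => hi⟩
    · exact ⟨0, fun h => absurd h hlt⟩
  choose i hi using hex
  -- Each block supplies a bad index, and different blocks supply different ones.
  refine absurd h (not_lt.2 ?_)
  calc k / m = (Finset.range (k / m)).card := (Finset.card_range _).symm
    _ ≤ _ := by
      refine Finset.card_le_card_of_injOn (fun b => b * m + i b) (fun b hb' => ?_) ?_
      · have hlt : b < k / m := by simpa using hb'
        have := hb b hlt
        have := hi b hlt
        simp only [Finset.coe_filter, Finset.mem_range, Set.mem_ofPred_eq]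
        exact ⟨by omega, this.2⟩
      · intro b hb1 b' hb2 heq
        have l1 : i b < m := (hi b (by simpa using hb1)).1
        have l2 : i b' < m := (hi b' (by simpa using hb2)).1
        have hm : 0 < m := by omega
        have e := congrArg (· / m) heq
        simp only [mul_comm _ m, Nat.mul_add_div hm, Nat.div_eq_of_lt l1,
          Nat.div_eq_of_lt l2] at e
        simpa using e

/-! ### Choice of parameters and conclusion -/

/-- The parameter `√(log log p)`. -/
noncomputable def sqrtLogLog (p : ℕ) : ℝ := √(Real.log (Real.log p))

lemma tendsto_log_natCast : Filter.Tendsto (fun p : ℕ => Real.log p) Filter.atTop Filter.atTop :=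
  Real.tendsto_log_atTop.comp tendsto_natCast_atTop_atTop

lemma tendsto_sqrtLogLog : Filter.Tendsto sqrtLogLog Filter.atTop Filter.atTop :=
  Real.tendsto_sqrt_atTop.comp (Real.tendsto_log_atTop.comp tendsto_log_natCast)

lemma log_eq_exp_sqrtLogLog_sq {p : ℕ} (hp : 2 ≤ p) (ht : 0 < sqrtLogLog p) :
    Real.log p = Real.exp (sqrtLogLog p ^ 2) := by
  have hl : 0 < Real.log p := Real.log_pos (by exact_mod_cast hp)
  unfold sqrtLogLog at *
  rw [Real.sq_sqrt (Real.sqrt_pos.1 ht).le, Real.exp_log hl]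

lemma eventually_two_mul_log_rpow_le (L : ℝ) :
    ∀ᶠ p : ℕ in Filter.atTop, 2 * Real.log p ^ L ≤ p := by
  have h := (isLittleO_rpow_exp_atTop L).bound (by norm_num : (0 : ℝ) < 1 / 2)
  filter_upwards [tendsto_log_natCast.eventually h, Filter.eventually_ge_atTop 1] with p hp hp1
  have hp0 : (0 : ℝ) < p := by exact_mod_cast hp1
  rw [Real.exp_log hp0, Real.norm_of_nonneg hp0.le] at hp
  have := (le_abs_self _).trans hp
  linarith

set_option maxHeartbeats 1000000 in
/-- For large `p`, a critical set has density more than `1 - exp (t - t² / 4)`, where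
`t = √(log log p)`, on some progression of length `⌈(log p) ^ L⌉`. -/
theorem eventually_exists_apAverage_gt {d : ℝ} (hd : 0 < d) {L : ℝ} (hL : 1 ≤ L) :
    ∀ᶠ p : ℕ in Filter.atTop, ∀ [Fact p.Prime] (S : Finset (ZMod p)), IsCriticalSet d S →
      ∃ r a : ZMod p, r ≠ 0 ∧ 1 - Real.exp (sqrtLogLog p - sqrtLogLog p ^ 2 / 4) <
        apAverage (ind S) r ⌈Real.log p ^ L⌉₊ a := by
  obtain ⟨c, hc, p₀, hp₀⟩ := exists_forall_le_apSumNT hd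
  have hsmall := (Real.tendsto_pow_mul_exp_neg_atTop_nhds_zero 2).comp tendsto_sqrtLogLog
  have hbig := Real.tendsto_exp_atTop.comp tendsto_sqrtLogLog
  filter_upwards [Filter.eventually_ge_atTop p₀, Filter.eventually_ge_atTop 3,
    tendsto_sqrtLogLog.eventually_ge_atTop 6,
    hsmall.eventually (gt_mem_nhds (by positivity : 0 < c ^ 2 / (500 ^ 2 * (L + 3)))),
    hbig.eventually_ge_atTop (26000 / c)] with p hpp₀ hp3 ht6 he1 he2
  intro _ S hS
  simp only [Function.comp_apply] at he1 he2
  have hcS := hp₀ p hpp₀ S hS.1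
  have hlog := log_eq_exp_sqrtLogLog_sq (by omega : 2 ≤ p) (by linarith)
  set t := sqrtLogLog p with ht
  set l := Real.log p with hl
  have hp0 : (0 : ℝ) < p := by exact_mod_cast (by omega : 0 < p)
  have hpl : (p : ℝ) = Real.exp l := (Real.exp_log hp0).symm
  have htt : 6 * t ≤ t ^ 2 := by nlinarith
  have hl1 : 1 ≤ l := by rw [hlog]; exact Real.one_le_exp (by positivity)
  have hl0 : 0 < l := by linarith
  have hlp : l ≤ p := by rw [hpl]; linarith [Real.add_one_le_exp l]
  have hsqrt : l / 2 ≤ √(p : ℝ) := by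
    rw [hpl, ← Real.exp_half]; linarith [Real.add_one_le_exp (l / 2)]
  -- The extra factor `exp t` makes `δ ^ 4 * l = exp (4 * t)`, which outgrows the `(L + 3) * t ^ 2`
  -- coming from `log Q`.
  set δ := Real.exp (t - t ^ 2 / 4) with hδ
  have hδ0 : 0 < δ := Real.exp_pos _
  -- From `t ≥ 6`, `t - t ^ 2 / 4 ≤ -3`; the bound `1 / 18` is what `54 * q ≤ p` requires.
  have hδ18 : δ ≤ 1 / 18 := by
    have h3 : (18 : ℝ) ≤ Real.exp 3 := by
      have h1 := Real.exp_one_gt_d9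
      have : Real.exp 3 = Real.exp 1 ^ 3 := by rw [← Real.exp_nat_mul]; norm_num
      rw [this]
      calc (18 : ℝ) ≤ 2.7 ^ 3 := by norm_num
        _ ≤ _ := by gcongr; linarith
    calc δ ≤ Real.exp (-3) := Real.exp_le_exp.2 (by nlinarith)
      _ = 1 / Real.exp 3 := by rw [Real.exp_neg, one_div]
      _ ≤ _ := one_div_le_one_div_of_le (by norm_num) h3
  have hδ2 : δ ^ 2 = Real.exp (2 * t - t ^ 2 / 2) := by
    rw [hδ, ← Real.exp_nat_mul]; congr 1; push_cast; ring
  have hδ4 : δ ^ 4 * l = Real.exp (4 * t) := by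
    rw [hδ, ← Real.exp_nat_mul, hlog, ← Real.exp_add]; congr 1; push_cast; ring
  -- `26000 = 52 * 500`: the `500` comes from `τ = c * δ ^ 2 / 500`, and `52` exceeds `2 * 8 * π`.
  have hct : 26000 ≤ c * Real.exp t := by
    rw [div_le_iff₀ hc] at he2; linarith
  have hδl : ∀ s : ℝ, t ≤ s + 2 * t - t ^ 2 / 2 → 26000 ≤ c * δ ^ 2 * Real.exp s := fun s hs => by
    refine hct.trans ?_
    rw [mul_assoc, hδ2, ← Real.exp_add]
    gcongr
    linarith
  have hk2 : (⌈l ^ L⌉₊ : ℝ) ≤ 2 * l ^ L := by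
    have h1 : 1 ≤ l ^ L := Real.one_le_rpow hl1 (by linarith)
    linarith [Nat.ceil_lt_add_one (by positivity : 0 ≤ l ^ L)]
  have hQle : l ^ (L + 2) ≤ (⌈l ^ (L + 2)⌉₊ : ℝ) := Nat.le_ceil _
  have hQ2 : (⌈l ^ (L + 2)⌉₊ : ℝ) ≤ 2 * l ^ (L + 2) := by
    have h1 : 1 ≤ l ^ (L + 2) := Real.one_le_rpow hl1 (by linarith)
    linarith [Nat.ceil_lt_add_one (by positivity : 0 ≤ l ^ (L + 2))]
  have hQ0 : 0 < ⌈l ^ (L + 2)⌉₊ := Nat.ceil_pos.2 (by positivity)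
  have hk0 : 0 < ⌈l ^ L⌉₊ := Nat.ceil_pos.2 (by positivity)
  have hlogQ : Real.log ⌈l ^ (L + 2)⌉₊ ≤ (L + 3) * t ^ 2 := by
    calc _ ≤ Real.log (2 * l ^ (L + 2)) :=
          Real.log_le_log (by exact_mod_cast hQ0) hQ2
      _ = Real.log 2 + (L + 2) * t ^ 2 := by
          rw [Real.log_mul (by norm_num) (by positivity), Real.log_rpow hl0, hlog, Real.log_exp]
      _ ≤ _ := by nlinarith [Real.log_two_lt_d9]
  have hqle : 3 * (⌊δ * p / 3⌋₊ : ℝ) ≤ δ * p := by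
    linarith [Nat.floor_le (by positivity : 0 ≤ δ * p / 3)]
  have hx : δ / 2 ≤ 3 * (⌊δ * p / 3⌋₊ : ℝ) / p := by
    rw [le_div_iff₀ hp0]
    have h6 : 6 ≤ δ * p := by
      calc (6 : ℝ) ≤ Real.exp t := by linarith [Real.add_one_le_exp t]
        _ ≤ Real.exp (t - t ^ 2 / 4 + t ^ 2) := Real.exp_le_exp.2 (by nlinarith)
        _ = δ * l := by rw [Real.exp_add, ← hlog]
        _ ≤ _ := by gcongr
    linarith [Nat.lt_floor_add_one (δ * p / 3)]
  have hxle : 3 * (⌊δ * p / 3⌋₊ : ℝ) / p ≤ δ := by rwa [div_le_iff₀ hp0]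
  have hq54 : 54 * ⌊δ * p / 3⌋₊ ≤ p := by
    have : (54 * ⌊δ * p / 3⌋₊ : ℝ) ≤ p := by nlinarith
    exact_mod_cast this
  have hlogc : 1 / (c * δ ^ 2 / 500) ^ 2 * Real.log ⌈l ^ (L + 2)⌉₊ < l := by
    have hexp : Real.exp (-t) * Real.exp (4 * t) ≥ 1 := by
      rw [← Real.exp_add]; exact Real.one_le_exp (by linarith)
    have h1 : (L + 3) * t ^ 2 * 500 ^ 2 < c ^ 2 * Real.exp (4 * t) := by
      rw [lt_div_iff₀ (by positivity)] at he1
      calc _ ≤ (L + 3) * t ^ 2 * 500 ^ 2 * (Real.exp (-t) * Real.exp (4 * t)) :=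
            le_mul_of_one_le_right (by positivity) hexp
        _ = t ^ 2 * Real.exp (-t) * (500 ^ 2 * (L + 3)) * Real.exp (4 * t) := by ring
        _ < _ := by gcongr
    calc _ ≤ 1 / (c * δ ^ 2 / 500) ^ 2 * ((L + 3) * t ^ 2) := by gcongr
      _ = ((L + 3) * t ^ 2 * 500 ^ 2) / (c ^ 2 * δ ^ 4) := by field_simp
      _ < l := by
        rw [div_lt_iff₀ (by positivity)]
        calc _ < c ^ 2 * Real.exp (4 * t) := h1
          _ = _ := by rw [← hδ4]; ring
  -- The left side is at most `4 * c * δ ^ 2 / 500`. Flooring `q` at worst halves `δ`, so the right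
  -- side is at least `c * δ ^ 2 / 72`. Taking `Q` about `l ^ 2` times longer than `k` makes the
  -- middle term small.
  have herr : 2 * (c * δ ^ 2 / 500) + 8 * Real.pi * ⌈l ^ L⌉₊ / ⌈l ^ (L + 2)⌉₊ + 12 / √(p : ℝ) <
      c * (3 * (⌊δ * p / 3⌋₊ : ℝ) / p) ^ 2 / 18 := by
    have e1 : 8 * Real.pi * ⌈l ^ L⌉₊ / ⌈l ^ (L + 2)⌉₊ ≤ c * δ ^ 2 / 500 := by
      rw [div_le_iff₀ (by exact_mod_cast hQ0)]
      have h26 := hδl (2 * t ^ 2) (by nlinarith)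
      have hl2 : Real.exp (2 * t ^ 2) = l ^ 2 := by
        rw [hlog, ← Real.exp_nat_mul]; norm_num
      rw [hl2] at h26
      calc 8 * Real.pi * ⌈l ^ L⌉₊ ≤ 8 * 3.15 * (2 * l ^ L) := by
            gcongr; exact Real.pi_lt_d2.le
        _ ≤ 26000 / 500 * l ^ L := by
            have : 0 < l ^ L := by positivity
            linarith
        _ ≤ c * δ ^ 2 * l ^ 2 / 500 * l ^ L := by gcongr
        _ = c * δ ^ 2 / 500 * l ^ (L + 2) := by
            rw [Real.rpow_add hl0, Real.rpow_two]; ring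
        _ ≤ _ := by gcongr
    have e2 : 12 / √(p : ℝ) ≤ c * δ ^ 2 / 500 := by
      rw [div_le_iff₀ (by positivity)]
      have h26 := hδl (t ^ 2) (by nlinarith)
      rw [← hlog] at h26
      calc (12 : ℝ) ≤ c * δ ^ 2 / 500 * (l / 2) := by linarith
        _ ≤ _ := by gcongr
    have e3 : c * (δ / 2) ^ 2 / 18 ≤ c * (3 * (⌊δ * p / 3⌋₊ : ℝ) / p) ^ 2 / 18 := by gcongr
    have e4 : 0 < c * δ ^ 2 := by positivity
    calc _ ≤ 2 * (c * δ ^ 2 / 500) + c * δ ^ 2 / 500 + c * δ ^ 2 / 500 := by gcongr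
      _ < c * (δ / 2) ^ 2 / 18 := by linarith
      _ ≤ _ := e3
  obtain ⟨r, a, hr, hra⟩ := hS.exists_apAverage_gt (by omega) hcS (by positivity) hk0 hQ0 hq54
    hlogc herr
  exact ⟨r, a, hr, by linarith⟩

lemma log_rpow_eq_exp {p : ℕ} (hp : 2 ≤ p) (ht : 0 < sqrtLogLog p) :
    Real.log p ^ ((1 / 4 : ℝ) + -2 / sqrtLogLog p) =
      Real.exp (sqrtLogLog p ^ 2 / 4 - 2 * sqrtLogLog p) := by
  rw [log_eq_exp_sqrtLogLog_sq hp ht, ← Real.exp_mul]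
  congr 1
  field_simp
  ring

/-- Fewer than `δ * k ≤ k / (2 * m)` points are missing, too few to meet all `k / m` disjoint blocks
of length `m`; `2 * m ≤ k` covers the floor in `k / m`. -/
lemma exists_isAPOfLength_of_apAverage_gt {p : ℕ} [Fact p.Prime] {S : Finset (ZMod p)} {k m : ℕ}
    {r a : ZMod p} {δ : ℝ} (hr : r ≠ 0) (hk0 : 0 < k) (hkp : k ≤ p) (hm : 0 < m)
    (h : 1 - δ < apAverage (ind S) r k a) (hδ : m * δ ≤ 1 / 2) (hmk : 2 * m ≤ k) :
    ∃ A : Finset (ZMod p), IsAPOfLength A m ∧ A ⊆ S := by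
  have hkR : (0 : ℝ) < k := by exact_mod_cast hk0
  have hmR : (0 : ℝ) < m := by exact_mod_cast hm
  have hmiss : (((Finset.range k).filter fun j : ℕ => ¬ a + (j : ZMod p) * r ∈ S).card : ℝ) =
      k - k * apAverage (ind S) r k a := by
    have h1 := Finset.card_filter_add_card_filter_not (s := Finset.range k)
      (fun j : ℕ => a + (j : ZMod p) * r ∈ S)
    have h2 : (((Finset.range k).filter fun j : ℕ => a + (j : ZMod p) * r ∈ S).card : ℝ) =
        k * apAverage (ind S) r k a := by
      unfold apAverage
      rw [mul_div_cancel₀ _ hkR.ne']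
      simp [ind]
    rw [Finset.card_range] at h1
    have h3 := congrArg (Nat.cast (R := ℝ)) h1
    push_cast at h3
    linarith
  have hlt : ((Finset.range k).filter fun j : ℕ => ¬ a + (j : ZMod p) * r ∈ S).card < k / m := by
    set c := ((Finset.range k).filter fun j : ℕ => ¬ a + (j : ZMod p) * r ∈ S).card
    have h4 : (c : ℝ) < δ * k := by rw [hmiss]; nlinarith
    have h5 : (m * (c + 1) : ℝ) ≤ k := by
      have h6 : (m : ℝ) * c ≤ m * (δ * k) := by gcongr
      have h7 : (m * δ) * k ≤ 1 / 2 * k := by gcongr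
      have h8 : (2 * m : ℝ) ≤ k := by exact_mod_cast hmk
      nlinarith
    have h9 : (c + 1) * m ≤ k := by
      rw [mul_comm]; exact_mod_cast h5
    exact (Nat.le_div_iff_mul_le hm).2 h9
  obtain ⟨b, hb, hP⟩ := exists_block hlt
  refine ⟨_, isAPOfLength_image (by omega : m ≤ p) (a + (b * m : ℕ) * r) hr, fun x hx => ?_⟩
  obtain ⟨i, hi, rfl⟩ := Finset.mem_image.1 hx
  have := hP i (Finset.mem_range.1 hi)
  rw [Nat.cast_add, add_mul, ← add_assoc] at this
  exact this

theorem theorem1 :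
    ∃ ε : ℕ → ℝ, Filter.Tendsto ε Filter.atTop (nhds 0) ∧
      ∀ d : ℝ, 0 < d → d ≤ 1 →
        (∃ p₀ : ℕ, ∀ (p : ℕ) [Fact p.Prime], p₀ ≤ p →
          ∀ S : Finset (ZMod p), IsCriticalSet d S →
            ∃ (A : Finset (ZMod p)) (k : ℕ), IsAPOfLength A k ∧ A ⊆ S ∧
              (k : ℝ) ≥ Real.log p ^ ((1 / 4 : ℝ) + ε p)) ∧
        (∀ L : ℝ, 1 ≤ L →
          ∃ p₀ : ℕ, ∀ (p : ℕ) [Fact p.Prime], p₀ ≤ p →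
            ∀ S : Finset (ZMod p), IsCriticalSet d S →
              ∃ (N : Finset (ZMod p)) (k : ℕ), IsAPOfLength N k ∧
                (k : ℝ) ≥ Real.log p ^ L ∧
                ((S ∩ N).card : ℝ) >
                  (N.card : ℝ) * (1 - 1 / Real.log p ^ ((1 / 4 : ℝ) + ε p))) := by
  -- The density deficit is `(log p) ^ (-1/4 + 1/t)`. Using `2` instead of `1` leaves a factor `exp
  -- t` to absorb constants. `d` and `L` affect only how large `p` must be.
  refine ⟨fun p => -2 / sqrtLogLog p, tendsto_sqrtLogLog.const_div_atTop _,
    fun d hd _ => ⟨?_, fun L hL => ?_⟩⟩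
  · have hev : ∀ᶠ p : ℕ in Filter.atTop, ∀ [Fact p.Prime] (S : Finset (ZMod p)),
        IsCriticalSet d S → ∃ (A : Finset (ZMod p)) (k : ℕ), IsAPOfLength A k ∧ A ⊆ S ∧
          (k : ℝ) ≥ Real.log p ^ ((1 / 4 : ℝ) + -2 / sqrtLogLog p) := by
      -- `L = 1` suffices: blocks of length about `(log p) ^ (1/4)` fit many times into `⌈log p⌉`
      -- terms.
      filter_upwards [eventually_exists_apAverage_gt hd le_rfl, Filter.eventually_ge_atTop 2,
        eventually_two_mul_log_rpow_le 1, tendsto_sqrtLogLog.eventually_ge_atTop 8]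
        with p hp hp2 hlp ht8
      intro _ S hS
      obtain ⟨r, a, hr, hra⟩ := hp S hS
      rw [log_rpow_eq_exp hp2 (by linarith)]
      have hlog := log_eq_exp_sqrtLogLog_sq hp2 (by linarith)
      rw [Real.rpow_one] at hra hlp
      set t := sqrtLogLog p
      have ht2 : 8 * t ≤ t ^ 2 := by nlinarith
      have hl1 : 1 ≤ Real.log p := by rw [hlog]; exact Real.one_le_exp (by positivity)
      have hy1 : 1 ≤ Real.exp (t ^ 2 / 4 - 2 * t) := Real.one_le_exp (by linarith)
      have hm2 : (⌈Real.exp (t ^ 2 / 4 - 2 * t)⌉₊ : ℝ) ≤ 2 * Real.exp (t ^ 2 / 4 - 2 * t) := by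
        linarith [Nat.ceil_lt_add_one (zero_le_one.trans hy1)]
      have h4 : (4 : ℝ) ≤ Real.exp t := by linarith [Real.add_one_le_exp t]
      obtain ⟨A, hA, hAS⟩ := exists_isAPOfLength_of_apAverage_gt hr
        (k := ⌈Real.log p⌉₊) (m := ⌈Real.exp (t ^ 2 / 4 - 2 * t)⌉₊)
        (Nat.ceil_pos.2 (by linarith)) (Nat.ceil_le.2 (by linarith))
        (Nat.ceil_pos.2 (by linarith)) hra
        (by
          calc _ ≤ 2 * Real.exp (t ^ 2 / 4 - 2 * t) * Real.exp (t - t ^ 2 / 4) := by gcongr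
            _ = 2 * (Real.exp t)⁻¹ := by
              rw [mul_assoc, ← Real.exp_add, ← Real.exp_neg]; congr 2; ring
            _ ≤ 2 * 4⁻¹ := by gcongr
            _ = 1 / 2 := by norm_num)
        (by
          have : (2 * ⌈Real.exp (t ^ 2 / 4 - 2 * t)⌉₊ : ℝ) ≤ ⌈Real.log p⌉₊ := by
            calc _ ≤ 4 * Real.exp (t ^ 2 / 4 - 2 * t) := by linarith
              _ ≤ Real.exp t * Real.exp (t ^ 2 / 4 - 2 * t) := by gcongr
              _ ≤ Real.log p := by
                rw [hlog, ← Real.exp_add]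
                exact Real.exp_le_exp.2 (by nlinarith)
              _ ≤ _ := Nat.le_ceil _
          exact_mod_cast this)
      exact ⟨A, _, hA, hAS, Nat.le_ceil _⟩
    obtain ⟨p₀, h⟩ := Filter.eventually_atTop.1 hev
    exact ⟨p₀, fun p _ hp S hS => h p hp S hS⟩
  · have hev : ∀ᶠ p : ℕ in Filter.atTop, ∀ [Fact p.Prime] (S : Finset (ZMod p)),
        IsCriticalSet d S → ∃ (N : Finset (ZMod p)) (k : ℕ), IsAPOfLength N k ∧
          (k : ℝ) ≥ Real.log p ^ L ∧ ((S ∩ N).card : ℝ) > (N.card : ℝ) *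
            (1 - 1 / Real.log p ^ ((1 / 4 : ℝ) + -2 / sqrtLogLog p)) := by
      filter_upwards [eventually_exists_apAverage_gt hd hL, Filter.eventually_ge_atTop 2,
        eventually_two_mul_log_rpow_le L, tendsto_sqrtLogLog.eventually_ge_atTop 1]
        with p hp hp2 hlp ht1
      intro _ S hS
      obtain ⟨r, a, hr, hra⟩ := hp S hS
      have hlog := log_eq_exp_sqrtLogLog_sq hp2 (by linarith)
      rw [log_rpow_eq_exp hp2 (by linarith), one_div, ← Real.exp_neg]
      have hl0 : 0 < Real.log p := by rw [hlog]; exact Real.exp_pos _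
      have hlL : 0 < Real.log p ^ L := by positivity
      set t := sqrtLogLog p
      have hk0 : 0 < ⌈Real.log p ^ L⌉₊ := Nat.ceil_pos.2 hlL
      have hkp : ⌈Real.log p ^ L⌉₊ ≤ p := Nat.ceil_le.2 (by linarith)
      have hN := isAPOfLength_image hkp a hr
      refine ⟨_, _, hN, Nat.le_ceil _, ?_⟩
      obtain ⟨_, _, _, hNc⟩ := hN
      rw [hNc, card_inter_image_eq hk0 hkp S a hr]
      have hexp : Real.exp (t - t ^ 2 / 4) ≤ Real.exp (-(t ^ 2 / 4 - 2 * t)) :=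
        Real.exp_le_exp.2 (by linarith)
      have hkR : (0 : ℝ) < ⌈Real.log p ^ L⌉₊ := by exact_mod_cast hk0
      exact mul_lt_mul_of_pos_left (by linarith) hkR
    obtain ⟨p₀, h⟩ := Filter.eventually_atTop.1 hev
    exact ⟨p₀, fun p _ hp S hS => h p hp S hS⟩
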